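/- Let $N\ge 1$ be an integer, let $0<b<\min\{2,N\}$ and put $\sigma_b=\frac{4-2b}{N}+2$. For a measurable $f:\mathbb R^N\to\mathbb C$ let $$\|f\|_{L_b^{\sigma_b}}=\Big(\int_{\mathbb R^N}|x|^{-b}|f(x)|^{\sigma_b}\,dx\Big)^{1/\sigma_b},$$ and let $L_b^{\sigma_b}(\mathbb R^N)$ be the space of those $f$ for which this is finite. Let $S(t)=e^{it\Delta}$ be the free Schrödinger group, acting on tempered distributions as the Fourier multiplier that solves $i\partial_t u+\Delta u=0$. Then there is a constant $C>0$, depending only on $N$ and $b$, such that for all $t\neq 0$ and all $f\in L_b^{\sigma_b}(\mathbb R^N)$ the function $|x|^{-b}|f|^{\sigma_b-1}$ defines a tempered distribution, $S(t)\big[|x|^{-b}|f|^{\sigma_b-1}\big]$ is a function in $L_b^{\sigma_b}(\mathbb R^N)$, and $$\big\|S(t)\big[|x|^{-b}|f|^{\sigma_b-1}\big]\big\|_{L_b^{\sigma_b}}\le C\,|t|^{-2/\sigma_b}\,\|f\|_{L_b^{\sigma_b}}^{\sigma_b-1}.$$ -/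

import Mathlib

open MeasureTheory
open scoped ENNReal SchwartzMap

namespace INLS

/-- The exponent `σ_b = (4 - 2b)/N + 2`. -/
noncomputable def sigma (N : ℕ) (b : ℝ) : ℝ := (4 - 2 * b) / N + 2

/-- The norm of the weighted Lebesgue space `L_b^{σ_b}(ℝ^N)`, that is
`(∫ |x|^{-b} |f(x)|^{σ_b} dx)^{1/σ_b}`, with values in `[0, ∞]`. -/
noncomputable def weightedNorm (N : ℕ) (b : ℝ) (f : EuclideanSpace ℝ (Fin N) → ℂ) : ℝ≥0∞ :=
  (∫⁻ x, ENNReal.ofReal (‖x‖ ^ (-b)) * ‖f x‖ₑ ^ sigma N b) ^ (1 / sigma N b)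

/-- Membership in the weighted Lebesgue space `L_b^{σ_b}(ℝ^N)`. -/
def MemWeighted (N : ℕ) (b : ℝ) (f : EuclideanSpace ℝ (Fin N) → ℂ) : Prop :=
  AEStronglyMeasurable f volume ∧ weightedNorm N b f < ∞

/-- The function `|x|^{-b} |f(x)|^{σ_b - 1}`. -/
noncomputable def nonlinearTerm (N : ℕ) (b : ℝ) (f : EuclideanSpace ℝ (Fin N) → ℂ) :
    EuclideanSpace ℝ (Fin N) → ℂ :=
  fun x => ((‖x‖ ^ (-b) * ‖f x‖ ^ (sigma N b - 1) : ℝ) : ℂ)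

/-- The symbol of `e^{itΔ}`. Mathlib's Fourier transform has kernel `e^{-2πi⟨x,ξ⟩}`, so that the
symbol of `Δ` is `-4π²|ξ|²`. -/
noncomputable def schrodingerSymbol (N : ℕ) (t : ℝ) (ξ : EuclideanSpace ℝ (Fin N)) : ℂ :=
  Complex.exp (((-(4 * Real.pi ^ 2 * t) * ‖ξ‖ ^ 2 : ℝ) : ℂ) * Complex.I)

/-- The free Schrödinger group `S(t) = e^{itΔ}` on tempered distributions: the Fourier multiplier
with symbol `e^{-4π²it|ξ|²}`. -/
noncomputable def schrodingerGroup (N : ℕ) (t : ℝ) :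
    𝓢'(EuclideanSpace ℝ (Fin N), ℂ) →L[ℂ] 𝓢'(EuclideanSpace ℝ (Fin N), ℂ) :=
  TemperedDistribution.fourierMultiplierCLM ℂ (schrodingerSymbol N t)

/-- The tempered distribution `T` is the function `u`: integration against `u` converges absolutely
for every Schwartz function and is the action of `T`. -/
def IsRepresentedBy (N : ℕ) (T : 𝓢'(EuclideanSpace ℝ (Fin N), ℂ))
    (u : EuclideanSpace ℝ (Fin N) → ℂ) : Prop :=
  ∀ φ : 𝓢(EuclideanSpace ℝ (Fin N), ℂ),
    Integrable (fun x => φ x * u x) volume ∧ T φ = ∫ x, φ x * u x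

/-- `u = S(t) h` for functions `h` and `u`: both define tempered distributions, and the group
`S(t)` maps the first to the second. -/
def IsSchrodingerEvolution (N : ℕ) (t : ℝ) (h u : EuclideanSpace ℝ (Fin N) → ℂ) : Prop :=
  ∃ H : 𝓢'(EuclideanSpace ℝ (Fin N), ℂ),
    IsRepresentedBy N H h ∧ IsRepresentedBy N (schrodingerGroup N t H) u

/-- The symbol has temperate growth, so that the Fourier multiplier is the genuine one. -/
theorem schrodingerSymbol_hasTemperateGrowth (N : ℕ) (t : ℝ) :
    (schrodingerSymbol N t).HasTemperateGrowth := by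
  have key : ∀ n : ℕ, ∀ r : ℝ, iteratedDeriv n (fun r : ℝ => Complex.exp (r * Complex.I)) r
      = Complex.I ^ n * Complex.exp (r * Complex.I) := by
    intro n
    induction n with
    | zero => intro r; simp
    | succ k ih =>
      intro r
      rw [iteratedDeriv_succ, funext ih]
      have h : HasDerivAt (fun r : ℝ => Complex.exp (r * Complex.I))
          (Complex.exp (r * Complex.I) * (1 * Complex.I)) r :=
        ((Complex.ofRealCLM.hasDerivAt (x := r)).mul_const Complex.I).cexp
      rw [(h.const_mul (Complex.I ^ k)).deriv]
      ring
  have h1 : (fun r : ℝ => Complex.exp (r * Complex.I)).HasTemperateGrowth := by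
    refine ⟨?_, fun n => ⟨0, 1, fun r => ?_⟩⟩
    · exact (Complex.ofRealCLM.contDiff.mul contDiff_const).cexp
    · rw [norm_iteratedFDeriv_eq_norm_iteratedDeriv, key]
      simp [Complex.norm_exp_ofReal_mul_I]
  have h2 : (fun ξ : EuclideanSpace ℝ (Fin N) =>
      -(4 * Real.pi ^ 2 * t) * ‖ξ‖ ^ 2).HasTemperateGrowth :=
    (Function.HasTemperateGrowth.const _).mul (Function.hasTemperateGrowth_norm_sq _)
  exact h1.comp h2

end INLS

/-! Write q = σ_b, μ = |x|^{-b}dx and g = |f|^{q-1}. The claim is that the linear operator g ↦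
S(t)[|x|^{-b}g] maps L^{q'}(μ) to L^q(μ), by interpolation between two endpoints. L¹(μ) → L^∞ is the
dispersive estimate with constant (4π|t|)^{-N/2} (`exists_evolution_of_integrable`). L²(μ) → L²(μ)
is the weighted bound ∫|S(t)h|²|x|^{-b} ≤ C|t|^{-b}∫|h|²|y|^b with h = |x|^{-b}g
(`exists_evolution_weighted_two`). The powers of t combine to |t|^{-2/q} because (N/2)(q-2) = 2-b.

For the weighted bound, |x|^{-b} is an integral over the radii R > |x|, so it suffices to control
S(t)h on each ball |x| < R. The data are split at |y| = |t|/R: the far part is handled by the L²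
bound, the near part by the dispersive estimate and Cauchy-Schwarz with weight |y|^d, b < d < N.
Here d < N makes |y|^{-d} integrable at the origin, and b < d makes the later integral in R converge
there. Tonelli then restores the weight |y|^b.

The interpolation is carried out by hand, as in Marcinkiewicz's theorem. For each level l the data
are split where |f| crosses the height S/l, chosen so that the high part contributes at most l/2;
Chebyshev treats the low part (`meas_lt_norm_le`), and integration over l converges at 0 because q >
2 (`lintegral_rpow_le_of_meas_le`). -/

namespace INLS

open Filter Topology Set FourierTransform

variable {N : ℕ} {t : ℝ}

/-! ### The Schrödinger kernel as a limit of Gaussians -/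

/-- The bound `(4π|t|)^{-N/2}` of the Schrödinger kernel. -/
noncomputable def dispersiveConst (N : ℕ) (t : ℝ) : ℝ := (4 * Real.pi * |t|) ^ (-(N / 2 : ℝ))

/-- The Gaussian kernel `(π/c)^{N/2} e^{-π²|z|²/c}`. -/
noncomputable def gaussKernel (N : ℕ) (c : ℂ) (z : EuclideanSpace ℝ (Fin N)) : ℂ :=
  (Real.pi / c) ^ (N / 2 : ℂ) * Complex.exp (-Real.pi ^ 2 * ‖z‖ ^ 2 / c)

/-- The kernel of the free Schrödinger group. -/
noncomputable def schrodingerKernel (N : ℕ) (t : ℝ) : EuclideanSpace ℝ (Fin N) → ℂ :=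
  gaussKernel N ((4 * Real.pi ^ 2 * t : ℝ) * Complex.I)

/-- For purely imaginary c the Gaussian exponent is purely imaginary, so only the prefactor
contributes to the modulus. -/
theorem norm_schrodingerKernel (ht : t ≠ 0) (z : EuclideanSpace ℝ (Fin N)) :
    ‖schrodingerKernel N t z‖ = dispersiveConst N t := by
  have hπ := Real.pi_pos
  rw [schrodingerKernel, gaussKernel, norm_mul]
  have h1 : -(Real.pi : ℂ) ^ 2 * ‖z‖ ^ 2 / ((4 * Real.pi ^ 2 * t : ℝ) * Complex.I)
      = ((‖z‖ ^ 2 / (4 * t) : ℝ) : ℂ) * Complex.I := by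
    have : (t : ℂ) ≠ 0 := by exact_mod_cast ht
    have : (Real.pi : ℂ) ≠ 0 := by exact_mod_cast hπ.ne'
    push_cast
    field_simp
    simp
  rw [h1, Complex.norm_exp_ofReal_mul_I, mul_one]
  have h2 : (N / 2 : ℂ) = ((N / 2 : ℝ) : ℂ) := by push_cast; rfl
  have hne : (Real.pi : ℂ) / ((4 * Real.pi ^ 2 * t : ℝ) * Complex.I) ≠ 0 := by
    simp [ht, hπ.ne']
  rw [h2, Complex.norm_cpow_real, norm_div, norm_mul, Complex.norm_I, mul_one,
    Complex.norm_real, Complex.norm_real, Real.norm_of_nonneg hπ.le, Real.norm_eq_abs,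
    abs_mul, abs_of_pos (by positivity : 0 < 4 * Real.pi ^ 2), dispersiveConst,
    Real.rpow_neg (by positivity), ← Real.inv_rpow (by positivity)]
  congr 1
  have := abs_pos.2 ht
  field_simp

theorem continuous_gaussKernel (c : ℂ) : Continuous (gaussKernel N c) := by
  unfold gaussKernel; fun_prop

/-- The action of the multiplier on test functions, integrated against a Gaussian-damped symbol. -/
theorem integral_gauss_mul_fourierInv (c : ℂ) (hc : 0 < c.re)
    (φ : 𝓢(EuclideanSpace ℝ (Fin N), ℂ)) (y : EuclideanSpace ℝ (Fin N)) :
    ∫ ξ, Complex.exp (-c * ‖ξ‖ ^ 2 + 2 * Real.pi * Complex.I * inner ℝ (-y) ξ) * (𝓕⁻ φ) ξ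
      = ∫ w, gaussKernel N c (w - y) * φ w := by
  have J := GaussianFourier.integrable_cexp_neg_mul_sq_norm_add (V := EuclideanSpace ℝ (Fin N))
    hc (2 * Real.pi * Complex.I) (-y)
  have hφ : Integrable (fun w => φ (-w)) volume := φ.integrable.comp_neg
  -- The Fourier transform is moved from φ onto the Gaussian, where it is explicit; this needs Re c
  -- > 0.
  have h1 := VectorFourier.integral_fourierIntegral_smul_eq_flip (L := innerₗ _)
      Real.continuous_fourierChar continuous_inner J hφ
  have h2 : ⇑(𝓕⁻ φ : 𝓢(EuclideanSpace ℝ (Fin N), ℂ)) = 𝓕 (fun w => φ (-w)) := by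
    rw [SchwartzMap.fourierInv_coe]
    exact Real.fourierInv_eq_fourier_comp_neg _
  rw [h2]
  have h3 : ∀ w, 𝓕 (fun ξ : EuclideanSpace ℝ (Fin N) =>
      Complex.exp (-c * ‖ξ‖ ^ 2 + 2 * Real.pi * Complex.I * inner ℝ (-y) ξ)) w
      = gaussKernel N c (-w - y) := by
    intro w
    rw [fourier_gaussian_innerProductSpace' hc, gaussKernel, finrank_euclideanSpace_fin,
      show -y - w = -w - y by abel]
  calc _ = ∫ w, gaussKernel N c (-w - y) * φ (-w) := by
        simp_rw [← h3]
        simpa using! h1.symm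
    _ = _ := integral_neg_eq_self (fun w => gaussKernel N c (w - y) * φ w) volume

/-- If Re c ≥ 0 then Re(1/c) ≥ 0. The bound is uniform in c and so supplies the dominating function
when the damping is removed. -/
theorem norm_exp_gauss_le_one {c : ℂ} (hc : 0 ≤ c.re) (z : EuclideanSpace ℝ (Fin N)) :
    ‖Complex.exp (-Real.pi ^ 2 * ‖z‖ ^ 2 / c)‖ ≤ 1 := by
  rw [Complex.norm_exp, Real.exp_le_one_iff]
  have : -(Real.pi : ℂ) ^ 2 * ‖z‖ ^ 2 / c = ((-(Real.pi ^ 2 * ‖z‖ ^ 2) : ℝ) : ℂ) * c⁻¹ := by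
    push_cast; ring
  rw [this, Complex.re_ofReal_mul, Complex.inv_re]
  have := div_nonneg hc (Complex.normSq_nonneg c)
  nlinarith [mul_nonneg (by positivity : 0 ≤ Real.pi ^ 2 * ‖z‖ ^ 2) this]

/-- The multiplier acts on test functions by integration against the Schrödinger kernel. -/
theorem fourier_symbol_mul_fourierInv (ht : t ≠ 0) (φ : 𝓢(EuclideanSpace ℝ (Fin N), ℂ))
    (y : EuclideanSpace ℝ (Fin N)) :
    𝓕 (SchwartzMap.smulLeftCLM ℂ (schrodingerSymbol N t) (𝓕⁻ φ)) y
      = ∫ w, schrodingerKernel N t (w - y) * φ w := by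
  set c₀ : ℂ := (4 * Real.pi ^ 2 * t : ℝ) * Complex.I with hc₀
  -- The oscillating symbol is not integrable, so it is damped by e^{-ε|ξ|²}; both sides of the
  -- Gaussian identity pass to the limit ε → 0+ by dominated convergence.
  let c : ℝ → ℂ := fun ε => ε + c₀
  have hre : ∀ ε, (c ε).re = ε := fun ε => by
    simp only [c, hc₀, Complex.add_re, Complex.ofReal_re, Complex.re_ofReal_mul, Complex.I_re,
      mul_zero, add_zero]
  have hc₀ne : c₀ ≠ 0 := by simp [hc₀, ht, Real.pi_ne_zero]
  have hclim : Tendsto c (𝓝[>] 0) (𝓝 c₀) := by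
    have : Continuous c := by fun_prop
    have h := this.tendsto 0
    simp only [c, Complex.ofReal_zero, zero_add] at h
    exact h.mono_left nhdsWithin_le_nhds
  have hpos : ∀ᶠ ε in 𝓝[>] (0 : ℝ), 0 < ε := self_mem_nhdsWithin
  have lim1 : Tendsto (fun ε => ∫ ξ, Complex.exp (-c ε * ‖ξ‖ ^ 2
      + 2 * Real.pi * Complex.I * inner ℝ (-y) ξ) * (𝓕⁻ φ) ξ) (𝓝[>] 0)
      (𝓝 (∫ ξ, Complex.exp (-c₀ * ‖ξ‖ ^ 2
      + 2 * Real.pi * Complex.I * inner ℝ (-y) ξ) * (𝓕⁻ φ) ξ)) := by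
    apply tendsto_integral_filter_of_dominated_convergence (fun ξ => ‖(𝓕⁻ φ) ξ‖)
    · exact .of_forall fun ε => (Continuous.mul (by fun_prop)
        (𝓕⁻ φ).continuous).aestronglyMeasurable
    · filter_upwards [hpos] with ε hε
      refine .of_forall fun ξ => ?_
      rw [norm_mul, Complex.norm_exp]
      refine mul_le_of_le_one_left (norm_nonneg _) (Real.exp_le_one_iff.2 ?_)
      have : -c ε * (‖ξ‖ : ℂ) ^ 2 + 2 * Real.pi * Complex.I * inner ℝ (-y) ξ
          = ((-(ε * ‖ξ‖ ^ 2) : ℝ) : ℂ)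
            + ((-(4 * Real.pi ^ 2 * t * ‖ξ‖ ^ 2) + 2 * Real.pi * inner ℝ (-y) ξ : ℝ) : ℂ)
              * Complex.I := by
        simp only [c, hc₀]; push_cast; ring
      rw [this]
      simp only [Complex.add_re, Complex.ofReal_re, Complex.re_ofReal_mul, Complex.I_re, mul_zero,
        add_zero]
      nlinarith [mul_nonneg hε.le (sq_nonneg ‖ξ‖)]
    · exact (𝓕⁻ φ).integrable.norm
    · refine .of_forall fun ξ => ?_
      exact (((hclim.neg.mul_const _).add_const _).cexp).mul_const _
  have lim2 : Tendsto (fun ε => ∫ w, gaussKernel N (c ε) (w - y) * φ w) (𝓝[>] 0)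
      (𝓝 (∫ w, gaussKernel N c₀ (w - y) * φ w)) := by
    simp only [gaussKernel, mul_assoc, integral_const_mul]
    apply Tendsto.mul
    · have hd : Tendsto (fun ε => (Real.pi : ℂ) / c ε) (𝓝[>] 0) (𝓝 (Real.pi / c₀)) :=
        tendsto_const_nhds.div hclim hc₀ne
      -- The limit π/c₀ is not real, hence off the branch cut of the complex power.
      refine hd.cpow tendsto_const_nhds (Or.inr ?_)
      rw [div_eq_mul_inv, Complex.im_ofReal_mul, Complex.inv_im]
      rw [show c₀.im = 4 * Real.pi ^ 2 * t by
        rw [hc₀, Complex.im_ofReal_mul, Complex.I_im, mul_one]]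
      have := Complex.normSq_pos.2 hc₀ne
      exact mul_ne_zero Real.pi_ne_zero (div_ne_zero (neg_ne_zero.2
        (by positivity)) this.ne')
    · apply tendsto_integral_filter_of_dominated_convergence (fun w => ‖φ w‖)
      · exact .of_forall fun ε => (Continuous.mul (by fun_prop) φ.continuous).aestronglyMeasurable
      · filter_upwards [hpos] with ε hε
        refine .of_forall fun w => ?_
        rw [norm_mul]
        exact mul_le_of_le_one_left (norm_nonneg _)
          (norm_exp_gauss_le_one (by rw [hre]; exact hε.le) _)
      · exact φ.integrable.norm
      · exact .of_forall fun w => ((tendsto_const_nhds.div hclim hc₀ne).cexp).mul_const _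
  have heq : ∀ᶠ ε in 𝓝[>] (0 : ℝ), ∫ ξ, Complex.exp (-c ε * ‖ξ‖ ^ 2
      + 2 * Real.pi * Complex.I * inner ℝ (-y) ξ) * (𝓕⁻ φ) ξ
      = ∫ w, gaussKernel N (c ε) (w - y) * φ w := by
    filter_upwards [hpos] with ε hε
    exact integral_gauss_mul_fourierInv _ (by rw [hre]; exact hε) φ y
  rw [schrodingerKernel, ← hc₀, ← tendsto_nhds_unique (lim1.congr' heq) lim2,
    SchwartzMap.fourier_coe, Real.fourier_eq']
  refine integral_congr_ae (.of_forall fun ξ => ?_)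
  simp only [smul_eq_mul,
    SchwartzMap.smulLeftCLM_apply_apply (schrodingerSymbol_hasTemperateGrowth N t)]
  rw [← mul_assoc, schrodingerSymbol, ← Complex.exp_add]
  congr 2
  simp only [hc₀, inner_neg_left, real_inner_comm y ξ]
  push_cast
  ring

/-! ### Functions as tempered distributions, uniqueness of the evolution -/

theorem schrodingerGroup_apply (T : 𝓢'(EuclideanSpace ℝ (Fin N), ℂ))
    (φ : 𝓢(EuclideanSpace ℝ (Fin N), ℂ)) :
    schrodingerGroup N t T φ
      = T (𝓕 (SchwartzMap.smulLeftCLM ℂ (schrodingerSymbol N t) (𝓕⁻ φ))) := rfl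

/-- Elements of `Lp` represent the associated tempered distributions. -/
theorem isRepresentedBy_toTemperedDistribution {p : ℝ≥0∞} [hp : Fact (1 ≤ p)]
    (v : Lp ℂ p (volume : Measure (EuclideanSpace ℝ (Fin N)))) :
    IsRepresentedBy N (v : 𝓢'(EuclideanSpace ℝ (Fin N), ℂ)) v := by
  intro φ
  have := ENNReal.HolderConjugate.inv_one_sub_inv' hp.out
  refine ⟨?_, by simp⟩
  exact MemLp.integrable_mul (p := (1 - p⁻¹)⁻¹) (q := p) (φ.memLp _ _) (Lp.memLp v)

theorem IsRepresentedBy.congr {T : 𝓢'(EuclideanSpace ℝ (Fin N), ℂ)}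
    {u v : EuclideanSpace ℝ (Fin N) → ℂ} (h : IsRepresentedBy N T u) (huv : u =ᵐ[volume] v) :
    IsRepresentedBy N T v := by
  intro φ
  have e : (fun x => φ x * u x) =ᵐ[volume] fun x => φ x * v x := by
    filter_upwards [huv] with x hx; rw [hx]
  exact ⟨(h φ).1.congr e, (h φ).2.trans (integral_congr_ae e)⟩

theorem IsRepresentedBy.add {T S : 𝓢'(EuclideanSpace ℝ (Fin N), ℂ)}
    {u v : EuclideanSpace ℝ (Fin N) → ℂ} (hu : IsRepresentedBy N T u)
    (hv : IsRepresentedBy N S v) : IsRepresentedBy N (T + S) (u + v) := by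
  intro φ
  have e : (fun x => φ x * (u + v) x) = fun x => φ x * u x + φ x * v x := by
    ext x; simp [mul_add]
  rw [e]
  refine ⟨(hu φ).1.add (hv φ).1, ?_⟩
  rw [integral_add (hu φ).1 (hv φ).1, ← (hu φ).2, ← (hv φ).2]
  rfl

theorem IsRepresentedBy.unique_left {T S : 𝓢'(EuclideanSpace ℝ (Fin N), ℂ)}
    {u v : EuclideanSpace ℝ (Fin N) → ℂ} (hu : IsRepresentedBy N T u)
    (hv : IsRepresentedBy N S v) (huv : u =ᵐ[volume] v) : T = S := by
  ext φ
  rw [(hu.congr huv φ).2, (hv φ).2]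

/-- A bump equal to 1 near x is a Schwartz function, and integrability of its product with u is
integrability of u near x. -/
theorem IsRepresentedBy.locallyIntegrable {T : 𝓢'(EuclideanSpace ℝ (Fin N), ℂ)}
    {u : EuclideanSpace ℝ (Fin N) → ℂ} (hu : IsRepresentedBy N T u) : LocallyIntegrable u := by
  intro x
  obtain ⟨g, hg1, hg2, hg3⟩ : ∃ g : EuclideanSpace ℝ (Fin N) → ℝ,
      (∀ y ∈ Metric.ball x 1, g y = 1) ∧ HasCompactSupport g ∧ ContDiff ℝ (⊤ : ℕ∞) g := by
    let f : ContDiffBump x := ⟨1, 2, one_pos, one_lt_two⟩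
    exact ⟨f, fun y hy => f.one_of_mem_closedBall (Metric.ball_subset_closedBall hy),
      f.hasCompactSupport, f.contDiff⟩
  have h₁ : HasCompactSupport (Complex.ofRealCLM ∘ g) := hg2.comp_left rfl
  have h₂ : ContDiff ℝ (⊤ : ℕ∞) (Complex.ofRealCLM ∘ g) := by fun_prop
  refine ⟨Metric.ball x 1, Metric.ball_mem_nhds x one_pos, ?_⟩
  have := (hu (h₁.toSchwartzMap h₂)).1.integrableOn (s := Metric.ball x 1)
  refine this.congr_fun (fun y hy => ?_) measurableSet_ball
  simp [hg1 y hy]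

theorem IsRepresentedBy.unique_right {T : 𝓢'(EuclideanSpace ℝ (Fin N), ℂ)}
    {u v : EuclideanSpace ℝ (Fin N) → ℂ} (hu : IsRepresentedBy N T u)
    (hv : IsRepresentedBy N T v) : u =ᵐ[volume] v := by
  refine ae_eq_of_integral_contDiff_smul_eq hu.locallyIntegrable hv.locallyIntegrable
    fun g hg hgc => ?_
  have h₁ : HasCompactSupport (Complex.ofRealCLM ∘ g) := hgc.comp_left rfl
  have h₂ : ContDiff ℝ (⊤ : ℕ∞) (Complex.ofRealCLM ∘ g) := by fun_prop
  have := (hu (h₁.toSchwartzMap h₂)).2.symm.trans (hv (h₁.toSchwartzMap h₂)).2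
  simpa using this

/-- The estimates below construct the evolution from splittings that depend on a radius or a height.
Uniqueness almost everywhere lets the bounds from all these splittings be applied to a single u. -/
theorem IsSchrodingerEvolution.unique {h h' u u' : EuclideanSpace ℝ (Fin N) → ℂ}
    (H : IsSchrodingerEvolution N t h u) (H' : IsSchrodingerEvolution N t h' u')
    (hh : h =ᵐ[volume] h') : u =ᵐ[volume] u' := by
  obtain ⟨T, hT, hu⟩ := H
  obtain ⟨T', hT', hu'⟩ := H'
  obtain rfl := hT.unique_left hT' hh
  exact hu.unique_right hu'

theorem IsSchrodingerEvolution.congr {h h' u : EuclideanSpace ℝ (Fin N) → ℂ}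
    (H : IsSchrodingerEvolution N t h u) (hh : h =ᵐ[volume] h') :
    IsSchrodingerEvolution N t h' u := by
  obtain ⟨T, hT, hu⟩ := H
  exact ⟨T, hT.congr hh, hu⟩

theorem IsSchrodingerEvolution.add {h h' u u' : EuclideanSpace ℝ (Fin N) → ℂ}
    (H : IsSchrodingerEvolution N t h u) (H' : IsSchrodingerEvolution N t h' u') :
    IsSchrodingerEvolution N t (h + h') (u + u') := by
  obtain ⟨T, hT, hu⟩ := H
  obtain ⟨T', hT', hu'⟩ := H'
  exact ⟨T + T', hT.add hT', by rw [map_add]; exact hu.add hu'⟩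

theorem IsSchrodingerEvolution.aestronglyMeasurable {h u : EuclideanSpace ℝ (Fin N) → ℂ}
    (H : IsSchrodingerEvolution N t h u) : AEStronglyMeasurable u volume := by
  obtain ⟨T, -, hu⟩ := H
  exact hu.locallyIntegrable.aestronglyMeasurable

/-! ### The two unweighted bounds -/

/-- The dispersive estimate: `S(t)` maps `L¹` to `L^∞`. -/
theorem exists_evolution_of_integrable (ht : t ≠ 0) {h : EuclideanSpace ℝ (Fin N) → ℂ}
    (hh : Integrable h) : ∃ u, IsSchrodingerEvolution N t h u ∧
      ∀ x, ‖u x‖ₑ ≤ ENNReal.ofReal (dispersiveConst N t) * ∫⁻ y, ‖h y‖ₑ := by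
  have hm : MemLp h 1 := memLp_one_iff_integrable.2 hh
  have hrep := (isRepresentedBy_toTemperedDistribution (hm.toLp h)).congr hm.coeFn_toLp
  have hD : 0 ≤ dispersiveConst N t := by
    rw [← norm_schrodingerKernel ht (0 : EuclideanSpace ℝ (Fin N))]; positivity
  have hKc : Continuous (schrodingerKernel N t) := continuous_gaussKernel _
  refine ⟨fun x => ∫ y, schrodingerKernel N t (x - y) * h y, ⟨_, hrep, fun φ => ?_⟩, fun x => ?_⟩
  -- The kernel is bounded, so φ ⊗ h being integrable justifies Fubini.
  · have hint : Integrable (fun p : EuclideanSpace ℝ (Fin N) × EuclideanSpace ℝ (Fin N) =>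
        schrodingerKernel N t (p.1 - p.2) * (φ p.1 * h p.2)) (volume.prod volume) := by
      refine (φ.integrable.mul_prod hh).bdd_mul (c := dispersiveConst N t)
        (Continuous.aestronglyMeasurable (by fun_prop)) (.of_forall fun p => ?_)
      exact (norm_schrodingerKernel ht _).le
    constructor
    · refine hint.integral_prod_left.congr (.of_forall fun x => ?_)
      simp only
      rw [← integral_const_mul]
      exact integral_congr_ae (.of_forall fun y => by simp only; ring)
    · rw [schrodingerGroup_apply, (hrep _).2]
      simp_rw [fourier_symbol_mul_fourierInv ht, ← integral_mul_const, ← integral_const_mul]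
      rw [integral_integral_swap]
      · exact integral_congr_ae (.of_forall fun x => integral_congr_ae (.of_forall fun y => by
          simp only; ring))
      · refine hint.swap.congr (.of_forall fun p => ?_)
        simp [Function.uncurry]; ring
  · refine (enorm_integral_le_lintegral_enorm _).trans_eq ?_
    rw [← lintegral_const_mul' _ _ ENNReal.ofReal_ne_top]
    refine lintegral_congr fun y => ?_
    rw [enorm_mul, ← ofReal_norm (schrodingerKernel N t _), norm_schrodingerKernel ht]

/-- `S(t)` is bounded on `L²`. -/
theorem exists_evolution_of_memLp_two {h : EuclideanSpace ℝ (Fin N) → ℂ}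
    (hh : MemLp h 2) : ∃ u, IsSchrodingerEvolution N t h u ∧
      ∫⁻ x, ‖u x‖ₑ ^ (2 : ℝ) ≤ ∫⁻ x, ‖h x‖ₑ ^ (2 : ℝ) := by
  have hrep := (isRepresentedBy_toTemperedDistribution (hh.toLp h)).congr hh.coeFn_toLp
  have hσ := schrodingerSymbol_hasTemperateGrowth N t
  have hσn : ∀ ξ, ‖schrodingerSymbol N t ξ‖ = 1 := fun ξ => by
    rw [schrodingerSymbol, Complex.norm_exp_ofReal_mul_I]
  have hσm : MemLp (schrodingerSymbol N t) ∞
      (volume : Measure (EuclideanSpace ℝ (Fin N))) :=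
    memLp_top_of_bound hσ.1.continuous.aestronglyMeasurable 1 (.of_forall fun ξ => (hσn ξ).le)
  set v : Lp ℂ 2 (volume : Measure (EuclideanSpace ℝ (Fin N))) :=
    𝓕⁻ ((hσm.toLp _) • (𝓕 (hh.toLp h)) : Lp ℂ 2 (volume : Measure (EuclideanSpace ℝ (Fin N)))) with hv
  -- The multiplier is computed inside L², where Plancherel and the unimodular symbol give the norm
  -- bound.
  have hS : schrodingerGroup N t (hh.toLp h : 𝓢'(EuclideanSpace ℝ (Fin N), ℂ)) = v := by
    rw [schrodingerGroup, TemperedDistribution.fourierMultiplierCLM_apply,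
      Lp.fourier_toTemperedDistribution_eq, ← Lp.toTemperedDistribution_smul_eq (q := 2) (r := 2) hσ hσm,
      Lp.fourierInv_toTemperedDistribution_eq]
  refine ⟨v, ⟨_, hrep, hS ▸ isRepresentedBy_toTemperedDistribution v⟩, ?_⟩
  have hnorm : ‖v‖ ≤ ‖hh.toLp h‖ := by
    have h1 : ‖v‖ = ‖((hσm.toLp _) • (𝓕 (hh.toLp h)) :
        Lp ℂ 2 (volume : Measure (EuclideanSpace ℝ (Fin N))))‖ := by
      rw [← Lp.norm_fourier_eq v, hv, fourier_fourierInv_eq]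
    rw [h1, ← Lp.norm_fourier_eq (hh.toLp h)]
    refine Lp.norm_le_norm_of_ae_le ?_
    filter_upwards [Lp.coeFn_lpSMul (r := 2) (hσm.toLp _) (𝓕 (hh.toLp h)), hσm.coeFn_toLp] with x h1 h2
    simp [h1, h2, hσn]
  have h2 : eLpNorm v 2 volume ≤ eLpNorm h 2 volume := by
    rw [Lp.norm_def, Lp.norm_def] at hnorm
    rw [← eLpNorm_congr_ae hh.coeFn_toLp]
    exact (ENNReal.toReal_le_toReal (Lp.memLp v).2.ne (Lp.memLp _).2.ne).1 hnorm
  rw [eLpNorm_eq_lintegral_rpow_enorm_toReal (by simp) (by simp),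
    eLpNorm_eq_lintegral_rpow_enorm_toReal (by simp) (by simp)] at h2
  simpa using (ENNReal.rpow_le_rpow_iff (by simp)).1 h2

/-! ### Tonelli and radial integrals -/

theorem lintegral_mul_setLIntegral_swap {α β : Type*} [MeasurableSpace α] [MeasurableSpace β]
    {μ : Measure α} {ν : Measure β} [SFinite μ] [SFinite ν] {F : α → ℝ≥0∞} {w : β → ℝ≥0∞}
    (hF : AEMeasurable F μ) (hw : Measurable w) {P : α → β → Prop}
    (hP : MeasurableSet {p : α × β | P p.1 p.2}) :
    ∫⁻ R, w R * ∫⁻ y in {y | P y R}, F y ∂μ ∂ν = ∫⁻ y, F y * ∫⁻ R in {R | P y R}, w R ∂ν ∂μ := by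
  have hP1 : ∀ R, MeasurableSet {y | P y R} := fun R => measurable_prodMk_right hP
  have hP2 : ∀ y, MeasurableSet {R | P y R} := fun y => measurable_prodMk_left hP
  have hm : AEMeasurable (Function.uncurry fun y R =>
      {p : α × β | P p.1 p.2}.indicator (fun p => F p.1 * w p.2) (y, R)) (μ.prod ν) :=
    ((hF.comp_quasiMeasurePreserving Measure.quasiMeasurePreserving_fst).mul
      (hw.comp measurable_snd).aemeasurable).indicator hP
  have hswap := lintegral_lintegral_swap hm
  calc _ = ∫⁻ R, ∫⁻ y, {p : α × β | P p.1 p.2}.indicator (fun p => F p.1 * w p.2) (y, R) ∂μ ∂ν := by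
        refine lintegral_congr fun R => ?_
        rw [← lintegral_const_mul'' _ hF.restrict, ← lintegral_indicator (hP1 R)]
        refine lintegral_congr fun y => ?_
        by_cases hp : P y R
        · rw [indicator_of_mem (show y ∈ {y | P y R} from hp),
            indicator_of_mem (show (y, R) ∈ {p : α × β | P p.1 p.2} from hp), mul_comm]
        · rw [indicator_of_notMem (show y ∉ {y | P y R} from hp),
            indicator_of_notMem (show (y, R) ∉ {p : α × β | P p.1 p.2} from hp)]
    _ = _ := by
        rw [← hswap]
        refine lintegral_congr fun y => ?_
        rw [← lintegral_const_mul _ hw, ← lintegral_indicator (hP2 y)]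
        refine lintegral_congr fun R => ?_
        by_cases hp : P y R
        · rw [indicator_of_mem (show R ∈ {R | P y R} from hp),
            indicator_of_mem (show (y, R) ∈ {p : α × β | P p.1 p.2} from hp)]
        · rw [indicator_of_notMem (show R ∉ {R | P y R} from hp),
            indicator_of_notMem (show (y, R) ∉ {p : α × β | P p.1 p.2} from hp)]

theorem setLIntegral_restrict_le {α : Type*} [MeasurableSpace α] {μ : Measure α} {S T U : Set α}
    (hS : MeasurableSet S) (h : S ∩ U ⊆ T) (w : α → ℝ≥0∞) :
    ∫⁻ x in S, w x ∂(μ.restrict U) ≤ ∫⁻ x in T, w x ∂μ := by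
  rw [Measure.restrict_restrict hS]
  exact lintegral_mono_set h

theorem lintegral_Ioi_rpow {c r : ℝ} (hc : 0 < c) (hr : 0 < r) :
    ∫⁻ R in Ioi r, ENNReal.ofReal (R ^ (-c - 1)) = ENNReal.ofReal (r ^ (-c) / c) := by
  rw [← ofReal_integral_eq_lintegral_ofReal (integrableOn_Ioi_rpow_of_lt (by linarith) hr)]
  · rw [integral_Ioi_rpow_of_lt (by linarith) hr]
    congr 1
    rw [show -c - 1 + 1 = -c by ring, neg_div_neg_eq]
  · filter_upwards [self_mem_ae_restrict measurableSet_Ioi] with R hR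
    exact Real.rpow_nonneg (hr.trans hR).le _

theorem lintegral_Ioc_rpow {c r : ℝ} (hc : 0 < c) (hr : 0 < r) :
    ∫⁻ R in Ioc 0 r, ENNReal.ofReal (R ^ (c - 1)) = ENNReal.ofReal (r ^ c / c) := by
  have hi : IntervalIntegrable (fun R : ℝ => R ^ (c - 1)) volume 0 r :=
    intervalIntegral.intervalIntegrable_rpow' (by linarith)
  rw [← ofReal_integral_eq_lintegral_ofReal
    ((intervalIntegrable_iff_integrableOn_Ioc_of_le hr.le).1 hi)]
  · rw [← intervalIntegral.integral_of_le hr.le, integral_rpow (Or.inl (by linarith))]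
    simp [Real.zero_rpow hc.ne']
  · filter_upwards [self_mem_ae_restrict measurableSet_Ioc] with R hR
    exact Real.rpow_nonneg hR.1.le _

/-- Scaling y ↦ ρy: the volume contributes ρ^N and the weight ρ^{-d}. No integrability is needed,
since both sides may be infinite. -/
theorem setLIntegral_norm_rpow {d ρ : ℝ} (hρ : 0 < ρ) :
    ∫⁻ y in {y : EuclideanSpace ℝ (Fin N) | ‖y‖ < ρ}, ENNReal.ofReal (‖y‖ ^ (-d))
      = ENNReal.ofReal (ρ ^ (N - d)) *
        ∫⁻ y in {y : EuclideanSpace ℝ (Fin N) | ‖y‖ < 1}, ENNReal.ofReal (‖y‖ ^ (-d)) := by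
  have hS : ∀ r : ℝ, MeasurableSet {y : EuclideanSpace ℝ (Fin N) | ‖y‖ < r} := fun r =>
    measurableSet_lt measurable_norm measurable_const
  let e := Homeomorph.smulOfNeZero (α := EuclideanSpace ℝ (Fin N)) ρ hρ.ne'
  set g : EuclideanSpace ℝ (Fin N) → ℝ≥0∞ :=
    {y | ‖y‖ < ρ}.indicator fun y => ENNReal.ofReal (‖y‖ ^ (-d)) with hg
  have h1 : ∫⁻ y, g (ρ • y) = ENNReal.ofReal (ρ ^ N)⁻¹ * ∫⁻ y, g y := by
    rw [← smul_eq_mul, ← lintegral_smul_measure]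
    have := Measure.map_addHaar_smul (volume : Measure (EuclideanSpace ℝ (Fin N))) hρ.ne'
    rw [finrank_euclideanSpace_fin, abs_of_pos (by positivity)] at this
    rw [← this]
    exact (e.toMeasurableEquiv.measurableEmbedding.lintegral_map g).symm
  have h2 : ∀ y, g (ρ • y) = ENNReal.ofReal (ρ ^ (-d)) *
      ({y : EuclideanSpace ℝ (Fin N) | ‖y‖ < 1}.indicator
        fun y => ENNReal.ofReal (‖y‖ ^ (-d))) y := by
    intro y
    have hn : ‖ρ • y‖ = ρ * ‖y‖ := by rw [norm_smul, Real.norm_of_nonneg hρ.le]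
    by_cases hy : ‖y‖ < 1
    · rw [hg, indicator_of_mem (show ρ • y ∈ {y : EuclideanSpace ℝ (Fin N) | ‖y‖ < ρ} from
          (by rw [hn]; nlinarith : ‖ρ • y‖ < ρ)),
        indicator_of_mem (show y ∈ {y : EuclideanSpace ℝ (Fin N) | ‖y‖ < 1} from hy), hn,
        Real.mul_rpow hρ.le (norm_nonneg _), ENNReal.ofReal_mul (by positivity)]
    · rw [hg, indicator_of_notMem (show ρ • y ∉ {y : EuclideanSpace ℝ (Fin N) | ‖y‖ < ρ} from
          (by rw [hn]; nlinarith : ¬ ‖ρ • y‖ < ρ)),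
        indicator_of_notMem (show y ∉ {y : EuclideanSpace ℝ (Fin N) | ‖y‖ < 1} from hy), mul_zero]
  simp_rw [h2] at h1
  rw [lintegral_const_mul' _ _ ENNReal.ofReal_ne_top, lintegral_indicator (hS 1), hg,
    lintegral_indicator (hS ρ)] at h1
  rw [sub_eq_add_neg, Real.rpow_add hρ, Real.rpow_natCast, ENNReal.ofReal_mul (by positivity),
    mul_assoc, h1, ← mul_assoc, ← ENNReal.ofReal_mul (by positivity),
    mul_inv_cancel₀ (by positivity), ENNReal.ofReal_one, one_mul]

theorem setLIntegral_norm_rpow_lt_top {d : ℝ} (hN : 0 < N) (hd : d < N) :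
    ∫⁻ y in {y : EuclideanSpace ℝ (Fin N) | ‖y‖ < 1}, ENNReal.ofReal (‖y‖ ^ (-d)) < ∞ := by
  have := integrableOn_ball_of_norm_le_rpow (E := EuclideanSpace ℝ (Fin N)) (F := ℝ)
    (μ := volume) (f := fun y => ‖y‖ ^ (-d)) (C := 1) (α := d) (r := 1)
    (by rw [finrank_euclideanSpace_fin]; exact hN) (by simpa using hd)
    (.of_forall fun y => by rw [Real.norm_of_nonneg (by positivity), one_mul])
    (Measurable.aestronglyMeasurable (by fun_prop))
  have h2 := this.2
  rw [hasFiniteIntegral_iff_norm] at h2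
  rw [show {y : EuclideanSpace ℝ (Fin N) | ‖y‖ < 1} = Metric.ball 0 1 by ext; simp]
  convert h2 using 3 with y
  rw [Real.norm_of_nonneg (by positivity)]

theorem ae_norm_pos (hN : 0 < N) : ∀ᵐ x : EuclideanSpace ℝ (Fin N), 0 < ‖x‖ := by
  have : Nontrivial (EuclideanSpace ℝ (Fin N)) := by
    apply Module.nontrivial_of_finrank_pos (R := ℝ)
    rwa [finrank_euclideanSpace_fin]
  filter_upwards [compl_mem_ae_iff.2 (measure_singleton (0 : EuclideanSpace ℝ (Fin N)))] with x hx
  exact norm_pos_iff.2 hx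

/-- Cauchy-Schwarz for |h| = |y|^{-d/2} · |h||y|^{d/2}, the first factor being evaluated by scaling.
-/
theorem sq_setLIntegral_enorm_le (hN : 0 < N) {d ρ : ℝ} (hρ : 0 < ρ)
    {h : EuclideanSpace ℝ (Fin N) → ℂ} (hm : AEStronglyMeasurable h volume) :
    (∫⁻ y in {y | ‖y‖ < ρ}, ‖h y‖ₑ) ^ (2 : ℝ) ≤ ENNReal.ofReal (ρ ^ (N - d)) *
      (∫⁻ y in {y : EuclideanSpace ℝ (Fin N) | ‖y‖ < 1}, ENNReal.ofReal (‖y‖ ^ (-d))) *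
      ∫⁻ y in {y | ‖y‖ < ρ}, ‖h y‖ₑ ^ (2 : ℝ) * ENNReal.ofReal (‖y‖ ^ d) := by
  have hsq : ∀ (x : EuclideanSpace ℝ (Fin N)) (c : ℝ),
      ENNReal.ofReal (‖x‖ ^ (c / 2)) ^ (2 : ℝ) = ENNReal.ofReal (‖x‖ ^ c) := by
    intro x c
    rw [ENNReal.ofReal_rpow_of_nonneg (by positivity) (by norm_num),
      ← Real.rpow_mul (norm_nonneg _), div_mul_cancel₀ _ two_ne_zero]
  rw [← setLIntegral_norm_rpow hρ]
  have hCS := ENNReal.lintegral_mul_le_Lp_mul_Lq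
    ((volume : Measure (EuclideanSpace ℝ (Fin N))).restrict {y | ‖y‖ < ρ})
    (Real.HolderConjugate.two_two)
    (f := fun y => ENNReal.ofReal (‖y‖ ^ (-d / 2)))
    (g := fun y => ‖h y‖ₑ * ENNReal.ofReal (‖y‖ ^ (d / 2)))
    (Measurable.aemeasurable (by fun_prop))
    (hm.restrict.enorm.mul (Measurable.aemeasurable (by fun_prop)))
  have hle : ∫⁻ y in {y | ‖y‖ < ρ}, ‖h y‖ₑ ≤ ∫⁻ y in {y | ‖y‖ < ρ},
      ENNReal.ofReal (‖y‖ ^ (-d / 2)) * (‖h y‖ₑ * ENNReal.ofReal (‖y‖ ^ (d / 2))) := by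
    refine lintegral_mono_ae ?_
    filter_upwards [ae_restrict_of_ae (ae_norm_pos hN)] with y hy
    rw [mul_comm, mul_assoc, ← ENNReal.ofReal_mul (by positivity), ← Real.rpow_add hy,
      show d / 2 + -d / 2 = 0 by ring, Real.rpow_zero, ENNReal.ofReal_one, mul_one]
  have := ENNReal.rpow_le_rpow (hle.trans hCS) (by norm_num : (0 : ℝ) ≤ 2)
  rw [ENNReal.mul_rpow_of_nonneg _ _ (by norm_num), ← ENNReal.rpow_mul, ← ENNReal.rpow_mul,
    one_div_mul_cancel two_ne_zero, ENNReal.rpow_one, ENNReal.rpow_one] at this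
  simpa only [hsq, ENNReal.mul_rpow_of_nonneg _ _ (by norm_num : (0 : ℝ) ≤ 2)] using this

/-! ### The weighted L² estimate -/

theorem exists_split_evolution (ht : t ≠ 0) {h : EuclideanSpace ℝ (Fin N) → ℂ}
    (hm : AEStronglyMeasurable h volume) {s : Set (EuclideanSpace ℝ (Fin N))}
    (hs : MeasurableSet s) (h1 : ∫⁻ y in s, ‖h y‖ₑ < ∞)
    (h2 : ∫⁻ y in sᶜ, ‖h y‖ₑ ^ (2 : ℝ) < ∞) :
    ∃ u₁ u₂, IsSchrodingerEvolution N t h (u₁ + u₂) ∧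
      (∀ x, ‖u₁ x‖ₑ ≤ ENNReal.ofReal (dispersiveConst N t) * ∫⁻ y in s, ‖h y‖ₑ) ∧
      ∫⁻ x, ‖u₂ x‖ₑ ^ (2 : ℝ) ≤ ∫⁻ y in sᶜ, ‖h y‖ₑ ^ (2 : ℝ) := by
  have i1 : Integrable (s.indicator h) :=
    IntegrableOn.integrable_indicator ⟨hm.restrict, h1⟩ hs
  have i2 : MemLp (sᶜ.indicator h) 2 := by
    refine (memLp_indicator_iff_restrict hs.compl).2 ⟨hm.restrict, ?_⟩
    rw [eLpNorm_eq_lintegral_rpow_enorm_toReal (by simp) (by simp)]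
    exact ENNReal.rpow_lt_top_of_nonneg (by simp) (by simpa using h2.ne)
  obtain ⟨u₁, e1, b1⟩ := exists_evolution_of_integrable ht i1
  obtain ⟨u₂, e2, b2⟩ := exists_evolution_of_memLp_two (t := t) i2
  refine ⟨u₁, u₂, ?_, fun x => ?_, b2.trans_eq ?_⟩
  · have := e1.add e2
    rwa [indicator_self_add_compl] at this
  · refine (b1 x).trans_eq ?_
    simp_rw [enorm_indicator_eq_indicator_enorm]
    rw [lintegral_indicator hs]
  · rw [← lintegral_indicator hs.compl]
    refine lintegral_congr fun x => ?_
    by_cases hx : x ∈ sᶜ <;> simp [hx]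

theorem enorm_add_rpow_two_le (z w : ℂ) :
    ‖z + w‖ₑ ^ (2 : ℝ) ≤ 2 * (‖z‖ₑ ^ (2 : ℝ) + ‖w‖ₑ ^ (2 : ℝ)) := by
  refine (ENNReal.rpow_le_rpow (enorm_add_le z w) (by norm_num)).trans ?_
  have := ENNReal.rpow_add_le_mul_rpow_add_rpow ‖z‖ₑ ‖w‖ₑ (p := 2) (by norm_num)
  rwa [show (2 : ℝ) - 1 = 1 by norm_num, ENNReal.rpow_one] at this

theorem volume_norm_lt {R : ℝ} (hR : 0 < R) :
    volume {x : EuclideanSpace ℝ (Fin N) | ‖x‖ < R} = ENNReal.ofReal (R ^ (N : ℝ)) *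
      volume {x : EuclideanSpace ℝ (Fin N) | ‖x‖ < 1} := by
  have : ∀ r : ℝ, {x : EuclideanSpace ℝ (Fin N) | ‖x‖ < r} = Metric.ball 0 r := fun r => by
    ext; simp
  rw [this, this, Measure.addHaar_ball_of_pos _ _ hR, finrank_euclideanSpace_fin,
    Real.rpow_natCast]

/-- The constant in the local estimate of `S(t)`. -/
noncomputable def localConst (N : ℕ) (d : ℝ) : ℝ≥0∞ :=
  2 * ENNReal.ofReal ((4 * Real.pi) ^ (-(N : ℝ))) *
    (∫⁻ y in {y : EuclideanSpace ℝ (Fin N) | ‖y‖ < 1}, ENNReal.ofReal (‖y‖ ^ (-d))) *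
    volume {x : EuclideanSpace ℝ (Fin N) | ‖x‖ < 1}

theorem localConst_ne_top {d : ℝ} (hN : 0 < N) (hd : d < N) : localConst N d ≠ ∞ := by
  refine ENNReal.mul_ne_top (ENNReal.mul_ne_top (by finiteness)
    (setLIntegral_norm_rpow_lt_top hN hd).ne) ?_
  rw [show {y : EuclideanSpace ℝ (Fin N) | ‖y‖ < 1} = Metric.ball 0 1 by ext; simp]
  exact measure_ball_lt_top.ne

/-- Splitting the data at `|y| = ρ` controls the evolution on the ball of radius `R`. -/
theorem exists_local_estimate (hN : 0 < N) (ht : t ≠ 0) {b d ρ : ℝ} (hb : 0 < b) (hbd : b < d)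
    (hd : d < N) (hρ : 0 < ρ) {h : EuclideanSpace ℝ (Fin N) → ℂ}
    (hm : AEStronglyMeasurable h volume)
    (hI : ∫⁻ y, ‖h y‖ₑ ^ (2 : ℝ) * ENNReal.ofReal (‖y‖ ^ b) < ∞) :
    ∃ u, IsSchrodingerEvolution N t h u ∧ ∀ R, 0 < R →
      ∫⁻ x in {x | ‖x‖ < R}, ‖u x‖ₑ ^ (2 : ℝ) ≤
        2 * (∫⁻ y in {y | ρ ≤ ‖y‖}, ‖h y‖ₑ ^ (2 : ℝ)) +
        localConst N d * ENNReal.ofReal (|t| ^ (-(N : ℝ)) * ρ ^ (N - d) * R ^ (N : ℝ)) *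
          ∫⁻ y in {y | ‖y‖ < ρ}, ‖h y‖ₑ ^ (2 : ℝ) * ENNReal.ofReal (‖y‖ ^ d) := by
  have hlt : ∀ r : ℝ, MeasurableSet {y : EuclideanSpace ℝ (Fin N) | ‖y‖ < r} := fun r =>
    measurableSet_lt measurable_norm measurable_const
  have hcompl : {y : EuclideanSpace ℝ (Fin N) | ‖y‖ < ρ}ᶜ = {y | ρ ≤ ‖y‖} := by
    ext; simp
  have hCS := sq_setLIntegral_enorm_le hN (d := d) hρ hm
  -- Inside the ball |y|^d ≤ ρ^{d-b}|y|^b; outside, for `hO`, 1 ≤ ρ^{-b}|y|^b.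
  have hW : ∫⁻ y in {y | ‖y‖ < ρ}, ‖h y‖ₑ ^ (2 : ℝ) * ENNReal.ofReal (‖y‖ ^ d) < ∞ := by
    refine lt_of_le_of_lt ?_ (ENNReal.mul_lt_top (ENNReal.ofReal_lt_top (r := ρ ^ (d - b))) hI)
    rw [← lintegral_const_mul' _ _ ENNReal.ofReal_ne_top]
    refine (setLIntegral_mono_ae' (hlt ρ) ?_).trans (setLIntegral_le_lintegral _ _)
    filter_upwards [ae_norm_pos hN] with y hy0 hy
    rw [mul_left_comm, ← ENNReal.ofReal_mul (by positivity)]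
    gcongr
    calc ‖y‖ ^ d = ‖y‖ ^ (d - b) * ‖y‖ ^ b := by rw [← Real.rpow_add hy0]; ring_nf
      _ ≤ _ := by
        gcongr
  have hO : ∫⁻ y in {y | ρ ≤ ‖y‖}, ‖h y‖ₑ ^ (2 : ℝ) < ∞ := by
    refine lt_of_le_of_lt ?_ (ENNReal.mul_lt_top (ENNReal.ofReal_lt_top (r := ρ ^ (-b))) hI)
    rw [← lintegral_const_mul' _ _ ENNReal.ofReal_ne_top]
    refine (setLIntegral_mono' (hcompl ▸ (hlt ρ).compl) fun y hy => ?_).trans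
      (setLIntegral_le_lintegral _ _)
    rw [mul_left_comm, ← ENNReal.ofReal_mul (by positivity)]
    refine le_mul_of_one_le_right' (ENNReal.one_le_ofReal.2 ?_)
    rw [Real.rpow_neg hρ.le, ← div_eq_inv_mul, one_le_div (by positivity)]
    exact Real.rpow_le_rpow hρ.le hy hb.le
  have h1 : ∫⁻ y in {y | ‖y‖ < ρ}, ‖h y‖ₑ < ∞ := by
    refine (ENNReal.rpow_lt_top_iff_of_pos (by norm_num : (0 : ℝ) < 2)).1 (hCS.trans_lt ?_)
    exact ENNReal.mul_lt_top (ENNReal.mul_lt_top ENNReal.ofReal_lt_top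
      (setLIntegral_norm_rpow_lt_top hN hd)) hW
  obtain ⟨u₁, u₂, he, b1, b2⟩ := exists_split_evolution ht hm (hlt ρ) h1 (by rwa [hcompl])
  rw [hcompl] at b2
  refine ⟨_, he, fun R hR => ?_⟩
  set V := ∫⁻ y in {y : EuclideanSpace ℝ (Fin N) | ‖y‖ < 1}, ENNReal.ofReal (‖y‖ ^ (-d)) with hV
  set W := ∫⁻ y in {y | ‖y‖ < ρ}, ‖h y‖ₑ ^ (2 : ℝ) * ENNReal.ofReal (‖y‖ ^ d) with hWdef
  have hD : ENNReal.ofReal (dispersiveConst N t) ^ (2 : ℝ)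
      = ENNReal.ofReal ((4 * Real.pi) ^ (-(N : ℝ))) * ENNReal.ofReal (|t| ^ (-(N : ℝ))) := by
    have hπ := Real.pi_pos
    rw [dispersiveConst, ENNReal.ofReal_rpow_of_nonneg (by positivity) (by norm_num),
      ← Real.rpow_mul (by positivity), ← ENNReal.ofReal_mul (by positivity),
      ← Real.mul_rpow (by positivity) (by positivity)]
    congr 2; ring
  have hu1 : ∀ x, ‖u₁ x‖ₑ ^ (2 : ℝ) ≤ ENNReal.ofReal ((4 * Real.pi) ^ (-(N : ℝ))) *
      ENNReal.ofReal (|t| ^ (-(N : ℝ))) * (ENNReal.ofReal (ρ ^ (N - d)) * V * W) := by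
    intro x
    refine (ENNReal.rpow_le_rpow (b1 x) (by norm_num)).trans ?_
    rw [ENNReal.mul_rpow_of_nonneg _ _ (by norm_num), hD]
    gcongr
  calc ∫⁻ x in {x | ‖x‖ < R}, ‖(u₁ + u₂) x‖ₑ ^ (2 : ℝ)
      ≤ ∫⁻ x in {x | ‖x‖ < R}, (2 * (ENNReal.ofReal ((4 * Real.pi) ^ (-(N : ℝ))) *
          ENNReal.ofReal (|t| ^ (-(N : ℝ))) * (ENNReal.ofReal (ρ ^ (N - d)) * V * W)) +
          2 * ‖u₂ x‖ₑ ^ (2 : ℝ)) := by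
        refine lintegral_mono fun x => (enorm_add_rpow_two_le _ _).trans ?_
        rw [mul_add]
        gcongr
        exact hu1 x
    _ = 2 * (ENNReal.ofReal ((4 * Real.pi) ^ (-(N : ℝ))) *
          ENNReal.ofReal (|t| ^ (-(N : ℝ))) * (ENNReal.ofReal (ρ ^ (N - d)) * V * W)) *
          volume {x : EuclideanSpace ℝ (Fin N) | ‖x‖ < R} +
          2 * ∫⁻ x in {x | ‖x‖ < R}, ‖u₂ x‖ₑ ^ (2 : ℝ) := by
        rw [lintegral_add_left measurable_const, lintegral_const, Measure.restrict_apply_univ,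
          lintegral_const_mul' _ _ (by simp)]
    _ ≤ _ := by
        rw [add_comm, volume_norm_lt hR, localConst, ← hV, ENNReal.ofReal_mul (by positivity),
          ENNReal.ofReal_mul (by positivity)]
        apply add_le_add
        · gcongr 2 * ?_
          exact (setLIntegral_le_lintegral _ _).trans b2
        · exact le_of_eq (by ring)

theorem measurable_setLIntegral_param {α β : Type*} [MeasurableSpace α] [MeasurableSpace β]
    {μ : Measure α} [SFinite μ] {F : α → ℝ≥0∞} (hF : AEMeasurable F μ) {P : α → β → Prop}
    (hP : MeasurableSet {p : α × β | P p.1 p.2}) :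
    Measurable fun R => ∫⁻ y in {y | P y R}, F y ∂μ := by
  have hm : Measurable ({p : α × β | P p.1 p.2}.indicator fun p => hF.mk F p.1) :=
    (hF.measurable_mk.comp measurable_fst).indicator hP
  convert! hm.lintegral_prod_left' (μ := μ) using 2 with R
  rw [lintegral_congr_ae (ae_restrict_of_ae hF.ae_eq_mk),
    ← lintegral_indicator (show MeasurableSet {y | P y R} from measurable_prodMk_right hP)]
  rfl

/-- Layer-cake form of the weight, an equality for r > 0. It is an inequality at r = 0 because there
r ^ (-b) takes the value 0. -/
theorem ofReal_rpow_neg_le_lintegral {b : ℝ} (hb : 0 < b) {r : ℝ} (hr : 0 ≤ r) :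
    ENNReal.ofReal (r ^ (-b)) ≤ ENNReal.ofReal b *
      ∫⁻ R in {R | r < R}, ENNReal.ofReal (R ^ (-b - 1)) ∂(volume.restrict (Ioi 0)) := by
  rcases hr.eq_or_lt with rfl | hr
  · simp [Real.zero_rpow (neg_ne_zero.2 hb.ne')]
  · have : {R | r < R} ∩ Ioi 0 = Ioi r := by
      ext R; exact ⟨fun h => h.1, fun h => ⟨h, hr.trans h⟩⟩
    rw [Measure.restrict_restrict (show MeasurableSet {R : ℝ | r < R} from measurableSet_Ioi), this,
      lintegral_Ioi_rpow hb hr,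
      ← ENNReal.ofReal_mul hb.le, mul_div_cancel₀ _ hb.ne']

/-- The condition T/R ≤ r means R ≥ T/r, so a power tail is integrated; after Tonelli this turns the
far part of the data into the weight |y|^b. -/
theorem lintegral_outer_radius_le {b T r : ℝ} (hb : 0 < b) (hT : 0 < T) (hr : 0 < r) :
    ∫⁻ R in {R | T / R ≤ r}, ENNReal.ofReal (R ^ (-b - 1)) ∂(volume.restrict (Ioi 0)) ≤
      ENNReal.ofReal (T ^ (-b) / b) * ENNReal.ofReal (r ^ b) := by
  refine (setLIntegral_restrict_le (T := Ici (T / r)) (measurableSet_le (by fun_prop) (by fun_prop))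
    ?_ _).trans_eq ?_
  · rintro R ⟨hR, hR0⟩
    exact (div_le_comm₀ hR0 hr).1 hR
  · rw [setLIntegral_congr Ioi_ae_eq_Ici.symm, lintegral_Ioi_rpow hb (by positivity),
      ← ENNReal.ofReal_mul (by positivity), Real.div_rpow hT.le hr.le, Real.rpow_neg hr.le]
    congr 1
    field_simp

theorem lintegral_inner_radius_le {c T r : ℝ} (hc : 0 < c) (hT : 0 < T) (hr : 0 < r) :
    ∫⁻ R in {R | r < T / R}, ENNReal.ofReal (R ^ (c - 1)) ∂(volume.restrict (Ioi 0)) ≤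
      ENNReal.ofReal (T ^ c / c) * ENNReal.ofReal (r ^ (-c)) := by
  refine (setLIntegral_restrict_le (T := Ioc 0 (T / r))
    (measurableSet_lt (by fun_prop) (by fun_prop)) ?_ _).trans_eq ?_
  · rintro R ⟨hR, hR0⟩
    exact ⟨hR0, ((lt_div_comm₀ hr hR0).1 hR).le⟩
  · rw [lintegral_Ioc_rpow hc (by positivity),
      ← ENNReal.ofReal_mul (by positivity), Real.div_rpow hT.le hr.le, Real.rpow_neg hr.le]
    congr 1
    field_simp

/-- The weighted `L²` estimate for the free Schrödinger group, with the constant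
`2 |t|^{-b} (1 + b A / (2(d - b)))`, where `A` is the local constant. -/
theorem exists_evolution_weighted_two (hN : 0 < N) (ht : t ≠ 0) {b d : ℝ} (hb : 0 < b)
    (hbd : b < d) (hd : d < N) {h : EuclideanSpace ℝ (Fin N) → ℂ}
    (hm : AEStronglyMeasurable h volume)
    (hI : ∫⁻ y, ‖h y‖ₑ ^ (2 : ℝ) * ENNReal.ofReal (‖y‖ ^ b) < ∞) :
    ∃ u, IsSchrodingerEvolution N t h u ∧
      ∫⁻ x, ‖u x‖ₑ ^ (2 : ℝ) * ENNReal.ofReal (‖x‖ ^ (-b)) ≤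
        (2 + ENNReal.ofReal (b / (d - b)) * localConst N d) * ENNReal.ofReal (|t| ^ (-b)) *
        ∫⁻ y, ‖h y‖ₑ ^ (2 : ℝ) * ENNReal.ofReal (‖y‖ ^ b) := by
  have hT : 0 < |t| := abs_pos.2 ht
  -- The radius 1 serves only to produce u; the bounds come from the other radii through uniqueness.
  obtain ⟨u, hu, -⟩ := exists_local_estimate hN ht hb hbd hd one_pos hm hI
  refine ⟨u, hu, ?_⟩
  have hF : AEMeasurable (fun y => ‖h y‖ₑ ^ (2 : ℝ)) volume := hm.enorm.pow_const _
  have hU : AEMeasurable (fun y => ‖u y‖ₑ ^ (2 : ℝ)) volume :=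
    hu.aestronglyMeasurable.enorm.pow_const _
  set A := localConst N d
  set I := ∫⁻ y, ‖h y‖ₑ ^ (2 : ℝ) * ENNReal.ofReal (‖y‖ ^ b) with hIdef
  have hdb : 0 < d - b := sub_pos.2 hbd
  -- The split radius is ρ = |t|/R, the scale at which |x||y|/|t| is of order 1.
  have hloc : ∀ R, 0 < R → ∫⁻ x in {x | ‖x‖ < R}, ‖u x‖ₑ ^ (2 : ℝ) ≤
        2 * (∫⁻ y in {y | |t| / R ≤ ‖y‖}, ‖h y‖ₑ ^ (2 : ℝ)) +
        A * ENNReal.ofReal (|t| ^ (-(N : ℝ)) * (|t| / R) ^ (N - d) * R ^ (N : ℝ)) *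
          ∫⁻ y in {y | ‖y‖ < |t| / R}, ‖h y‖ₑ ^ (2 : ℝ) * ENNReal.ofReal (‖y‖ ^ d) := by
    intro R hR
    obtain ⟨v, hv, hv'⟩ := exists_local_estimate hN ht hb hbd hd (div_pos hT hR) hm hI
    refine (lintegral_congr_ae ?_).trans_le (hv' R hR)
    filter_upwards [ae_restrict_of_ae (hu.unique hv .rfl)] with x hx
    rw [hx]
  have hw1 : Measurable fun R : ℝ => ENNReal.ofReal (R ^ (-b - 1)) := by fun_prop
  have hw2 : Measurable fun R : ℝ => ENNReal.ofReal (R ^ (d - b - 1)) := by fun_prop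
  have hG : AEMeasurable (fun y => ‖h y‖ₑ ^ (2 : ℝ) * ENNReal.ofReal (‖y‖ ^ d)) volume :=
    hF.mul (Measurable.aemeasurable (by fun_prop))
  have hout : Measurable fun R : ℝ => 2 * (ENNReal.ofReal (R ^ (-b - 1)) *
      ∫⁻ y in {y | |t| / R ≤ ‖y‖}, ‖h y‖ₑ ^ (2 : ℝ)) :=
    (hw1.mul (measurable_setLIntegral_param (P := fun y R => |t| / R ≤ ‖y‖) hF
      (measurableSet_le (by fun_prop) (by fun_prop)))).const_mul 2
  have outer : ∫⁻ R in Ioi (0 : ℝ), ENNReal.ofReal (R ^ (-b - 1)) *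
      ∫⁻ y in {y | |t| / R ≤ ‖y‖}, ‖h y‖ₑ ^ (2 : ℝ) ≤ ENNReal.ofReal (|t| ^ (-b) / b) * I := by
    rw [lintegral_mul_setLIntegral_swap (P := fun y R => |t| / R ≤ ‖y‖) hF hw1
      (measurableSet_le (by fun_prop) (by fun_prop)), hIdef,
      ← lintegral_const_mul' _ _ ENNReal.ofReal_ne_top]
    refine lintegral_mono_ae ?_
    filter_upwards [ae_norm_pos hN] with y hy
    rw [mul_left_comm]
    gcongr
    exact lintegral_outer_radius_le hb hT hy
  have inner : ∫⁻ R in Ioi (0 : ℝ), ENNReal.ofReal (R ^ (d - b - 1)) *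
      ∫⁻ y in {y | ‖y‖ < |t| / R}, ‖h y‖ₑ ^ (2 : ℝ) * ENNReal.ofReal (‖y‖ ^ d) ≤
      ENNReal.ofReal (|t| ^ (d - b) / (d - b)) * I := by
    rw [lintegral_mul_setLIntegral_swap (P := fun y R => ‖y‖ < |t| / R)
      hG hw2
      (measurableSet_lt (by fun_prop) (by fun_prop)), hIdef,
      ← lintegral_const_mul' _ _ ENNReal.ofReal_ne_top]
    refine lintegral_mono_ae ?_
    filter_upwards [ae_norm_pos hN] with y hy
    refine (mul_le_mul_right (lintegral_inner_radius_le hdb hT hy) _).trans_eq ?_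
    rw [show ‖y‖ ^ b = ‖y‖ ^ d * ‖y‖ ^ (-(d - b)) by rw [← Real.rpow_add hy]; ring_nf,
      ENNReal.ofReal_mul (by positivity)]
    ring
  calc ∫⁻ x, ‖u x‖ₑ ^ (2 : ℝ) * ENNReal.ofReal (‖x‖ ^ (-b))
      ≤ ∫⁻ x, ENNReal.ofReal b * (‖u x‖ₑ ^ (2 : ℝ) *
          ∫⁻ R in {R | ‖x‖ < R}, ENNReal.ofReal (R ^ (-b - 1)) ∂(volume.restrict (Ioi 0))) := by
        refine lintegral_mono fun x => ?_
        rw [mul_left_comm]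
        gcongr
        exact ofReal_rpow_neg_le_lintegral hb (norm_nonneg x)
    _ = ENNReal.ofReal b * ∫⁻ R in Ioi (0 : ℝ), ENNReal.ofReal (R ^ (-b - 1)) *
          ∫⁻ x in {x | ‖x‖ < R}, ‖u x‖ₑ ^ (2 : ℝ) := by
        rw [lintegral_const_mul' _ _ ENNReal.ofReal_ne_top,
          lintegral_mul_setLIntegral_swap (P := fun x R => ‖x‖ < R) hU hw1
            (measurableSet_lt (by fun_prop) (by fun_prop))]
    _ ≤ ENNReal.ofReal b * ∫⁻ R in Ioi (0 : ℝ), (2 * (ENNReal.ofReal (R ^ (-b - 1)) *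
          ∫⁻ y in {y | |t| / R ≤ ‖y‖}, ‖h y‖ₑ ^ (2 : ℝ)) +
          A * ENNReal.ofReal (|t| ^ (-d)) * (ENNReal.ofReal (R ^ (d - b - 1)) *
          ∫⁻ y in {y | ‖y‖ < |t| / R}, ‖h y‖ₑ ^ (2 : ℝ) * ENNReal.ofReal (‖y‖ ^ d))) := by
        gcongr ENNReal.ofReal b * ?_
        refine setLIntegral_mono' measurableSet_Ioi fun R (hR : 0 < R) => ?_
        refine (mul_le_mul_right (hloc R hR) _).trans_eq ?_
        -- The powers of R add up to d-b-1, integrable at R = 0 because b < d.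
        have e : ENNReal.ofReal (R ^ (-b - 1)) *
            ENNReal.ofReal (|t| ^ (-(N : ℝ)) * (|t| / R) ^ (N - d) * R ^ (N : ℝ)) =
            ENNReal.ofReal (|t| ^ (-d)) * ENNReal.ofReal (R ^ (d - b - 1)) := by
          rw [← ENNReal.ofReal_mul (by positivity), ← ENNReal.ofReal_mul (by positivity),
            Real.div_rpow hT.le hR.le, div_eq_mul_inv, ← Real.rpow_neg hR.le]
          congr 1
          calc _ = (|t| ^ (-(N : ℝ)) * |t| ^ (N - d)) *
                (R ^ (-b - 1) * R ^ (-(N - d)) * R ^ (N : ℝ)) := by ring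
            _ = _ := by
              rw [← Real.rpow_add hT, ← Real.rpow_add hR, ← Real.rpow_add hR]
              congr 2 <;> ring
        rw [mul_add, mul_left_comm, ← mul_assoc (ENNReal.ofReal (R ^ (-b - 1))),
          mul_left_comm (ENNReal.ofReal (R ^ (-b - 1))) A, e]
        ring
    _ = ENNReal.ofReal b * (2 * (∫⁻ R in Ioi (0 : ℝ), (ENNReal.ofReal (R ^ (-b - 1)) *
          ∫⁻ y in {y | |t| / R ≤ ‖y‖}, ‖h y‖ₑ ^ (2 : ℝ))) +
          A * ENNReal.ofReal (|t| ^ (-d)) * ∫⁻ R in Ioi (0 : ℝ), (ENNReal.ofReal (R ^ (d - b - 1)) *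
          ∫⁻ y in {y | ‖y‖ < |t| / R}, ‖h y‖ₑ ^ (2 : ℝ) * ENNReal.ofReal (‖y‖ ^ d))) := by
        have hA : A ≠ ∞ := localConst_ne_top hN hd
        rw [← lintegral_const_mul' _ _ (by simp : (2 : ℝ≥0∞) ≠ ∞),
          ← lintegral_const_mul' _ _ (by finiteness : A * ENNReal.ofReal (|t| ^ (-d)) ≠ ∞),
          lintegral_add_left hout]
    _ ≤ ENNReal.ofReal b * (2 * (ENNReal.ofReal (|t| ^ (-b) / b) * I) +
          A * ENNReal.ofReal (|t| ^ (-d)) * (ENNReal.ofReal (|t| ^ (d - b) / (d - b)) * I)) := by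
        gcongr
    _ = _ := by
        have e1 : ENNReal.ofReal b * ENNReal.ofReal (|t| ^ (-b) / b)
            = ENNReal.ofReal (|t| ^ (-b)) := by
          rw [← ENNReal.ofReal_mul hb.le, mul_div_cancel₀ _ hb.ne']
        have e2 : ENNReal.ofReal b * (ENNReal.ofReal (|t| ^ (-d)) *
            ENNReal.ofReal (|t| ^ (d - b) / (d - b)))
            = ENNReal.ofReal (b / (d - b)) * ENNReal.ofReal (|t| ^ (-b)) := by
          rw [← ENNReal.ofReal_mul (by positivity), ← ENNReal.ofReal_mul hb.le,
            ← ENNReal.ofReal_mul (by positivity),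
            show |t| ^ (-b) = |t| ^ (-d) * |t| ^ (d - b) by rw [← Real.rpow_add hT]; ring_nf]
          congr 1; ring
        calc _ = 2 * (ENNReal.ofReal b * ENNReal.ofReal (|t| ^ (-b) / b)) * I +
              A * (ENNReal.ofReal b * (ENNReal.ofReal (|t| ^ (-d)) *
                ENNReal.ofReal (|t| ^ (d - b) / (d - b)))) * I := by ring
          _ = _ := by rw [e1, e2]; ring

/-! ### Interpolation over the level sets of f -/

/-- The measure `|x|^{-b} dx`. -/
noncomputable def weightedMeasure (N : ℕ) (b : ℝ) : Measure (EuclideanSpace ℝ (Fin N)) :=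
  volume.withDensity fun x => ENNReal.ofReal (‖x‖ ^ (-b))

instance (N : ℕ) (b : ℝ) : SFinite (weightedMeasure N b) := by
  unfold weightedMeasure; infer_instance

theorem lintegral_weightedMeasure (b : ℝ) {g : EuclideanSpace ℝ (Fin N) → ℝ≥0∞}
    (hg : AEMeasurable g volume) :
    ∫⁻ x, g x ∂weightedMeasure N b = ∫⁻ x, ENNReal.ofReal (‖x‖ ^ (-b)) * g x :=
  lintegral_withDensity_eq_lintegral_mul₀ (Measurable.aemeasurable (by fun_prop)) hg

theorem enorm_nonlinearTerm (b : ℝ) (f : EuclideanSpace ℝ (Fin N) → ℂ) (hq : 1 ≤ sigma N b)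
    (x : EuclideanSpace ℝ (Fin N)) :
    ‖nonlinearTerm N b f x‖ₑ = ENNReal.ofReal (‖x‖ ^ (-b)) * ‖f x‖ₑ ^ (sigma N b - 1) := by
  rw [nonlinearTerm, ← ofReal_norm, Complex.norm_real, Real.norm_of_nonneg (by positivity),
    ENNReal.ofReal_mul (by positivity),
    ← ENNReal.ofReal_rpow_of_nonneg (norm_nonneg (f x)) (by linarith), ofReal_norm]

theorem measurable_nonlinearTerm (b : ℝ) {f : EuclideanSpace ℝ (Fin N) → ℂ} (hf : Measurable f) :
    Measurable (nonlinearTerm N b f) := by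
  unfold nonlinearTerm; fun_prop

/-- Splitting `f` at height `s` splits the evolution of the nonlinear term into a bounded part and
a part in the weighted `L²` space. -/
theorem exists_height_split (hN : 0 < N) (ht : t ≠ 0) {b d : ℝ} (hb : 0 < b) (hbd : b < d)
    (hd : d < N) (hq : 2 < sigma N b) {f : EuclideanSpace ℝ (Fin N) → ℂ} (hf : Measurable f)
    (hM : ∫⁻ x, ‖f x‖ₑ ^ sigma N b ∂weightedMeasure N b < ∞) {s : ℝ} (hs : 0 < s) :
    ∃ u₁ u₂, IsSchrodingerEvolution N t (nonlinearTerm N b f) (u₁ + u₂) ∧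
      (∀ x, ‖u₁ x‖ₑ ≤ ENNReal.ofReal (dispersiveConst N t) * (ENNReal.ofReal s⁻¹ *
        ∫⁻ x, ‖f x‖ₑ ^ sigma N b ∂weightedMeasure N b)) ∧
      AEStronglyMeasurable u₂ volume ∧
      ∫⁻ x, ‖u₂ x‖ₑ ^ (2 : ℝ) ∂weightedMeasure N b ≤
        (2 + ENNReal.ofReal (b / (d - b)) * localConst N d) * ENNReal.ofReal (|t| ^ (-b)) *
        ∫⁻ x in {x | ‖f x‖ ≤ s}, ‖f x‖ₑ ^ (2 * sigma N b - 2) ∂weightedMeasure N b := by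
  set q := sigma N b with hqdef
  set h := nonlinearTerm N b f with hh
  have hhm : Measurable h := measurable_nonlinearTerm b hf
  have hhn := enorm_nonlinearTerm b f (by linarith)
  have hS : MeasurableSet {x | s < ‖f x‖} := measurableSet_lt measurable_const hf.norm
  have hS' : MeasurableSet {x | ‖f x‖ ≤ s} := measurableSet_le hf.norm measurable_const
  have hcompl : {x | s < ‖f x‖}ᶜ = {x | ‖f x‖ ≤ s} := by ext; simp
  have hfq : ∀ p : ℝ, Measurable fun x => ‖f x‖ₑ ^ p := fun p => hf.enorm.pow_const p
  -- Where |f| > s, |f|^{q-1} ≤ s^{-1}|f|^q.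
  have hl1 : ∫⁻ x, ‖{x | s < ‖f x‖}.indicator h x‖ₑ ≤ ENNReal.ofReal s⁻¹ *
        ∫⁻ x, ‖f x‖ₑ ^ q ∂weightedMeasure N b := by
    rw [lintegral_weightedMeasure b (hfq q).aemeasurable,
      ← lintegral_const_mul' _ _ ENNReal.ofReal_ne_top]
    refine lintegral_mono fun x => ?_
    by_cases hx : s < ‖f x‖
    · rw [indicator_of_mem (show x ∈ {x | s < ‖f x‖} from hx), hhn, mul_left_comm]
      gcongr
      have hx0 : 0 < ‖f x‖ := hs.trans hx
      rw [← ofReal_norm, ENNReal.ofReal_rpow_of_pos hx0, ENNReal.ofReal_rpow_of_pos hx0,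
        ← ENNReal.ofReal_mul (by positivity)]
      refine ENNReal.ofReal_le_ofReal ?_
      rw [Real.rpow_sub hx0, Real.rpow_one, div_eq_inv_mul]
      gcongr
    · rw [indicator_of_notMem (show x ∉ {x | s < ‖f x‖} from hx)]
      simp
  -- The weights combine as |y|^{-2b}|y|^b = |y|^{-b}, off the origin.
  have hJ : ∫⁻ y, ‖{x | ‖f x‖ ≤ s}.indicator h y‖ₑ ^ (2 : ℝ) * ENNReal.ofReal (‖y‖ ^ b) =
      ∫⁻ x in {x | ‖f x‖ ≤ s}, ‖f x‖ₑ ^ (2 * q - 2) ∂weightedMeasure N b := by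
    rw [← lintegral_indicator hS', lintegral_weightedMeasure b
      ((hfq _).indicator hS').aemeasurable]
    refine lintegral_congr_ae ?_
    filter_upwards [ae_norm_pos hN] with y hy
    by_cases hx : ‖f y‖ ≤ s
    · rw [indicator_of_mem (show y ∈ {x | ‖f x‖ ≤ s} from hx),
        indicator_of_mem (show y ∈ {x | ‖f x‖ ≤ s} from hx), hhn,
        ENNReal.mul_rpow_of_nonneg _ _ (by norm_num), ← ENNReal.rpow_mul,
        show (q - 1) * 2 = 2 * q - 2 by ring, mul_right_comm,
        ENNReal.ofReal_rpow_of_nonneg (by positivity) (by norm_num), ← ENNReal.ofReal_mul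
        (by positivity), ← Real.rpow_mul hy.le, ← Real.rpow_add hy,
        show -b * 2 + b = -b by ring]
    · rw [indicator_of_notMem (show y ∉ {x | ‖f x‖ ≤ s} from hx),
        indicator_of_notMem (show y ∉ {x | ‖f x‖ ≤ s} from hx)]
      simp
  -- Where |f| ≤ s, |f|^{2q-2} ≤ s^{q-2}|f|^q, as q > 2.
  have hJfin : ∫⁻ x in {x | ‖f x‖ ≤ s}, ‖f x‖ₑ ^ (2 * q - 2) ∂weightedMeasure N b < ∞ := by
    refine lt_of_le_of_lt ?_ (ENNReal.mul_lt_top (ENNReal.ofReal_lt_top (r := s ^ (q - 2))) hM)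
    rw [← lintegral_const_mul' _ _ ENNReal.ofReal_ne_top]
    refine (setLIntegral_mono' hS' fun x hx => ?_).trans (setLIntegral_le_lintegral _ _)
    rw [show 2 * q - 2 = (q - 2) + q by ring,
      ENNReal.rpow_add_of_nonneg _ _ (by linarith) (by linarith)]
    gcongr
    rw [← ofReal_norm, ENNReal.ofReal_rpow_of_nonneg (norm_nonneg _) (by linarith)]
    exact ENNReal.ofReal_le_ofReal (Real.rpow_le_rpow (norm_nonneg _) hx (by linarith))
  have i1 : Integrable ({x | s < ‖f x‖}.indicator h) :=
    ⟨(hhm.indicator hS).aestronglyMeasurable,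
      hl1.trans_lt (ENNReal.mul_lt_top ENNReal.ofReal_lt_top hM)⟩
  obtain ⟨u₁, e1, b1⟩ := exists_evolution_of_integrable ht i1
  obtain ⟨u₂, e2, b2⟩ := exists_evolution_weighted_two hN ht hb hbd hd
    (hhm.indicator hS').aestronglyMeasurable (hJ ▸ hJfin)
  refine ⟨u₁, u₂, ?_, fun x => (b1 x).trans (by gcongr), e2.aestronglyMeasurable, ?_⟩
  · have := e1.add e2
    rwa [← hcompl, indicator_self_add_compl] at this
  · rw [lintegral_weightedMeasure b (e2.aestronglyMeasurable.enorm.pow_const _), ← hJ]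
    simpa only [mul_comm] using b2

/-- Restricted-type Chebyshev bound for the evolution of the nonlinear term. -/
theorem meas_lt_norm_le {b l : ℝ} {J : ℝ≥0∞} (hl : 0 < l)
    {u u₁ u₂ : EuclideanSpace ℝ (Fin N) → ℂ} (hu : u =ᵐ[volume] u₁ + u₂)
    (h1 : ∀ x, ‖u₁ x‖ₑ ≤ ENNReal.ofReal (l / 2)) (hm : AEStronglyMeasurable u₂ volume)
    (h2 : ∫⁻ x, ‖u₂ x‖ₑ ^ (2 : ℝ) ∂weightedMeasure N b ≤ J) :
    weightedMeasure N b {x | l < ‖u x‖} ≤ ENNReal.ofReal (4 * l ^ (-2 : ℝ)) * J := by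
  have hac : weightedMeasure N b ≪ volume := withDensity_absolutelyContinuous _ _
  have hl2 : 0 < (l / 2) ^ (2 : ℝ) := by positivity
  -- Since |u₁| ≤ l/2, the inequality |u| > l forces |u₂| ≥ l/2.
  have hsub : weightedMeasure N b {x | l < ‖u x‖} ≤
      weightedMeasure N b {x | ENNReal.ofReal ((l / 2) ^ (2 : ℝ)) ≤ ‖u₂ x‖ₑ ^ (2 : ℝ)} := by
    refine measure_mono_ae ?_
    filter_upwards [hac.ae_le hu] with x hx (hlx : l < ‖u x‖)
    show ENNReal.ofReal ((l / 2) ^ (2 : ℝ)) ≤ ‖u₂ x‖ₑ ^ (2 : ℝ)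
    have h3 : ‖u₁ x‖ ≤ l / 2 := by
      have := h1 x
      rwa [← ofReal_norm, ENNReal.ofReal_le_ofReal_iff (by positivity)] at this
    have h4 : ‖u x‖ ≤ ‖u₁ x‖ + ‖u₂ x‖ := by rw [hx]; exact norm_add_le _ _
    rw [← ofReal_norm, ENNReal.ofReal_rpow_of_nonneg (norm_nonneg _) (by norm_num)]
    exact ENNReal.ofReal_le_ofReal (Real.rpow_le_rpow (by positivity) (by linarith) (by norm_num))
  have hcheb := mul_meas_ge_le_lintegral₀
    ((hm.enorm.pow_const (2 : ℝ)).mono_ac hac) (ENNReal.ofReal ((l / 2) ^ (2 : ℝ)))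
  calc weightedMeasure N b {x | l < ‖u x‖}
      ≤ ENNReal.ofReal (4 * l ^ (-2 : ℝ)) * (ENNReal.ofReal ((l / 2) ^ (2 : ℝ)) *
        weightedMeasure N b {x | ENNReal.ofReal ((l / 2) ^ (2 : ℝ)) ≤ ‖u₂ x‖ₑ ^ (2 : ℝ)}) := by
        rw [← mul_assoc, ← ENNReal.ofReal_mul (by positivity)]
        have : 4 * l ^ (-2 : ℝ) * (l / 2) ^ (2 : ℝ) = 1 := by
          rw [Real.rpow_neg hl.le, Real.div_rpow hl.le (by norm_num)]
          have : l ^ (2 : ℝ) ≠ 0 := by positivity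
          field_simp
          norm_num
        rw [this, ENNReal.ofReal_one, one_mul]
        exact hsub
    _ ≤ _ := by gcongr; exact hcheb.trans h2

/-- The interpolation step: the `L^{σ_b}` norm of the evolution from the distributional bounds. -/
theorem lintegral_rpow_le_of_meas_le {α : Type*} [MeasurableSpace α] {μ : Measure α} [SFinite μ]
    {f u : α → ℂ} (hf : Measurable f) (hu : AEStronglyMeasurable u μ) {q S : ℝ} (hq : 2 < q)
    (hS : 0 < S) {K : ℝ≥0∞} (hK : K ≠ ∞)
    (hdist : ∀ l : ℝ, 0 < l → μ {x | l < ‖u x‖} ≤ ENNReal.ofReal (4 * l ^ (-2 : ℝ)) *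
      (K * ∫⁻ x in {x | ‖f x‖ ≤ S / l}, ‖f x‖ₑ ^ (2 * q - 2) ∂μ)) :
    ∫⁻ x, ‖u x‖ₑ ^ q ∂μ ≤
      ENNReal.ofReal (4 * q / (q - 2) * S ^ (q - 2)) * K * ∫⁻ x, ‖f x‖ₑ ^ q ∂μ := by
  have hq2 : 0 < q - 2 := by linarith
  have hq0 : 0 < q := by linarith
  have hw : Measurable fun l : ℝ => ENNReal.ofReal (l ^ (q - 2 - 1)) := by fun_prop
  have hF : Measurable fun x => ‖f x‖ₑ ^ (2 * q - 2) := hf.enorm.pow_const _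
  have hP : MeasurableSet {p : α × ℝ | ‖f p.1‖ ≤ S / p.2} :=
    measurableSet_le (hf.comp measurable_fst).norm (by fun_prop)
  calc ∫⁻ x, ‖u x‖ₑ ^ q ∂μ = ∫⁻ x, ENNReal.ofReal (‖u x‖ ^ q) ∂μ := by
        refine lintegral_congr fun x => ?_
        rw [← ofReal_norm, ENNReal.ofReal_rpow_of_nonneg (norm_nonneg _) hq0.le]
    _ = ENNReal.ofReal q * ∫⁻ l in Ioi 0, μ {x | l < ‖u x‖} * ENNReal.ofReal (l ^ (q - 1)) :=
        lintegral_rpow_eq_lintegral_meas_lt_mul μ (.of_forall fun x => norm_nonneg _)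
          hu.norm.aemeasurable hq0
    _ ≤ ENNReal.ofReal q * ∫⁻ l in Ioi 0, (4 * K) * (ENNReal.ofReal (l ^ (q - 2 - 1)) *
          ∫⁻ x in {x | ‖f x‖ ≤ S / l}, ‖f x‖ₑ ^ (2 * q - 2) ∂μ) := by
        gcongr ENNReal.ofReal q * ?_
        refine setLIntegral_mono' measurableSet_Ioi fun l (hl : 0 < l) => ?_
        refine (mul_le_mul_left (hdist l hl) _).trans_eq ?_
        have e : ENNReal.ofReal (4 * l ^ (-2 : ℝ)) * ENNReal.ofReal (l ^ (q - 1)) =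
            4 * ENNReal.ofReal (l ^ (q - 2 - 1)) := by
          rw [show (4 : ℝ≥0∞) = ENNReal.ofReal 4 by simp, ← ENNReal.ofReal_mul (by positivity),
            ← ENNReal.ofReal_mul (by positivity), mul_assoc, ← Real.rpow_add hl]
          ring_nf
        rw [mul_right_comm, e]
        ring
    _ = ENNReal.ofReal q * ((4 * K) * ∫⁻ x, ‖f x‖ₑ ^ (2 * q - 2) *
          ∫⁻ l in {l | ‖f x‖ ≤ S / l}, ENNReal.ofReal (l ^ (q - 2 - 1))
            ∂(volume.restrict (Ioi 0)) ∂μ) := by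
        rw [lintegral_const_mul' _ _ (by finiteness),
          lintegral_mul_setLIntegral_swap (P := fun x l => ‖f x‖ ≤ S / l) hF.aemeasurable hw hP]
    _ ≤ ENNReal.ofReal q * ((4 * K) * ∫⁻ x, ENNReal.ofReal (S ^ (q - 2) / (q - 2)) *
          ‖f x‖ₑ ^ q ∂μ) := by
        gcongr ENNReal.ofReal q * ((4 * K) * ?_)
        refine lintegral_mono fun x => ?_
        -- Where f vanishes every l > 0 is admitted and the l-integral diverges, but the factor
        -- |f|^{2q-2} = 0 annihilates it.
        rcases (norm_nonneg (f x)).eq_or_lt with h0 | h0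
        · have : f x = 0 := norm_eq_zero.1 h0.symm
          simp [this, ENNReal.zero_rpow_of_pos (by linarith : 0 < 2 * q - 2)]
        · have hle : ∫⁻ l in {l | ‖f x‖ ≤ S / l}, ENNReal.ofReal (l ^ (q - 2 - 1))
              ∂(volume.restrict (Ioi 0)) ≤ ENNReal.ofReal ((S / ‖f x‖) ^ (q - 2) / (q - 2)) := by
            rw [← lintegral_Ioc_rpow hq2 (by positivity)]
            refine setLIntegral_restrict_le (measurableSet_le (by fun_prop) (by fun_prop)) ?_ _
            rintro l ⟨hl, hl0⟩
            exact ⟨hl0, (le_div_comm₀ h0 hl0).1 hl⟩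
          refine (mul_le_mul_right hle _).trans_eq ?_
          rw [← ofReal_norm, ENNReal.ofReal_rpow_of_pos h0, ENNReal.ofReal_rpow_of_pos h0,
            ← ENNReal.ofReal_mul (by positivity), ← ENNReal.ofReal_mul (by positivity),
            Real.div_rpow hS.le h0.le, show 2 * q - 2 = (q - 2) + q by ring, Real.rpow_add h0]
          congr 1
          have : ‖f x‖ ^ (q - 2) ≠ 0 := by positivity
          field_simp
    _ = _ := by
        rw [lintegral_const_mul' _ _ ENNReal.ofReal_ne_top,
          show 4 * q / (q - 2) * S ^ (q - 2) = q * (4 * (S ^ (q - 2) / (q - 2))) by ring,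
          ENNReal.ofReal_mul hq0.le, ENNReal.ofReal_mul (by norm_num : (0 : ℝ) ≤ 4),
          show ENNReal.ofReal 4 = 4 by simp]
        ring

/-! ### Constants, powers of t and conclusion -/

theorem weightedNorm_eq (b : ℝ) {f : EuclideanSpace ℝ (Fin N) → ℂ}
    (hf : AEStronglyMeasurable f volume) :
    weightedNorm N b f = (∫⁻ x, ‖f x‖ₑ ^ sigma N b ∂weightedMeasure N b) ^ (1 / sigma N b) := by
  rw [weightedNorm, lintegral_weightedMeasure b (hf.enorm.pow_const _)]

theorem dispersiveConst_rpow (hN : 0 < N) (b : ℝ) (ht : t ≠ 0) :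
    dispersiveConst N t ^ (sigma N b - 2) =
      (4 * Real.pi) ^ (-(2 - b)) * |t| ^ (-(2 - b)) := by
  have hπ := Real.pi_pos
  have hN' : (N : ℝ) ≠ 0 := by positivity
  rw [dispersiveConst, ← Real.rpow_mul (by positivity),
    ← Real.mul_rpow (by positivity) (by positivity)]
  congr 1
  rw [sigma]
  field_simp
  ring

/-- The constant in the estimate for the `σ_b`-th power of the norm. -/
noncomputable def powerConst (N : ℕ) (b : ℝ) : ℝ :=
  4 * sigma N b / (sigma N b - 2) * 2 ^ (sigma N b - 2) * (4 * Real.pi) ^ (-(2 - b)) *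
    (2 + ENNReal.ofReal (b / ((N + b) / 2 - b)) * localConst N ((N + b) / 2)).toReal

theorem exists_evolution_nonlinearTerm (hN : 0 < N) (ht : t ≠ 0) {b : ℝ} (hb : 0 < b)
    (hbN : b < N) (hq : 2 < sigma N b) {f : EuclideanSpace ℝ (Fin N) → ℂ} (hf : Measurable f)
    (hM : ∫⁻ x, ‖f x‖ₑ ^ sigma N b ∂weightedMeasure N b < ∞) :
    ∃ u, IsSchrodingerEvolution N t (nonlinearTerm N b f) u ∧
      ∫⁻ x, ‖u x‖ₑ ^ sigma N b ∂weightedMeasure N b ≤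
        ENNReal.ofReal (powerConst N b * |t| ^ (-2 : ℝ)) *
          (∫⁻ x, ‖f x‖ₑ ^ sigma N b ∂weightedMeasure N b) ^ (sigma N b - 1) := by
  -- The auxiliary exponent d is taken as the midpoint of (b, N).
  have hbd : b < (N + b) / 2 := by linarith
  have hd : (N + b) / 2 < N := by linarith
  have hac : weightedMeasure N b ≪ volume := withDensity_absolutelyContinuous _ _
  have hT : 0 < |t| := abs_pos.2 ht
  obtain ⟨v₁, v₂, hu, -⟩ := exists_height_split hN ht hb hbd hd hq hf hM one_pos
  set u := v₁ + v₂
  refine ⟨u, hu, ?_⟩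
  set q := sigma N b with hqdef
  set M := ∫⁻ x, ‖f x‖ₑ ^ q ∂weightedMeasure N b with hMdef
  set A : ℝ≥0∞ := 2 + ENNReal.ofReal (b / ((N + b) / 2 - b)) * localConst N ((N + b) / 2) with hA
  have hAtop : A ≠ ∞ := by
    have := localConst_ne_top hN hd
    finiteness
  have hD : 0 < dispersiveConst N t := by
    have := Real.pi_pos
    unfold dispersiveConst; positivity
  -- A positive real majorant m replaces M so that the splitting height stays positive even when M =
  -- 0.
  have key : ∀ m : ℝ, 0 < m → M ≤ ENNReal.ofReal m →
      ∫⁻ x, ‖u x‖ₑ ^ q ∂weightedMeasure N b ≤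
        ENNReal.ofReal (powerConst N b * |t| ^ (-2 : ℝ)) * ENNReal.ofReal (m ^ (q - 2)) * M := by
    intro m hm hMm
    -- With S = 2Dm, D the dispersive constant, the height s = S/l gives D s^{-1} m = l/2, the bound
    -- required of the high part.
    have hS : 0 < 2 * dispersiveConst N t * m := by positivity
    refine (lintegral_rpow_le_of_meas_le hf (hu.aestronglyMeasurable.mono_ac hac) hq hS
      (K := A * ENNReal.ofReal (|t| ^ (-b))) (by finiteness) fun l hl => ?_).trans_eq ?_
    · obtain ⟨u₁, u₂, he, h1, hm2, h2⟩ :=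
        exists_height_split hN ht hb hbd hd hq hf hM (div_pos hS hl)
      refine meas_lt_norm_le hl (hu.unique he .rfl) (fun x => (h1 x).trans ?_) hm2 h2
      calc _ ≤ ENNReal.ofReal (dispersiveConst N t) *
            (ENNReal.ofReal (2 * dispersiveConst N t * m / l)⁻¹ * ENNReal.ofReal m) := by gcongr
        _ = _ := by
          rw [← ENNReal.ofReal_mul (by positivity), ← ENNReal.ofReal_mul (by positivity)]
          congr 1
          field_simp
    · have hq2 : 0 < q - 2 := by linarith
      have hπ := Real.pi_pos
      rw [powerConst, ← hA, ← mul_assoc, ← ENNReal.ofReal_toReal hAtop,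
        ← ENNReal.ofReal_mul (by positivity), ← ENNReal.ofReal_mul (by positivity),
        ← ENNReal.ofReal_mul (by positivity), ENNReal.toReal_ofReal ENNReal.toReal_nonneg]
      congr 2
      rw [Real.mul_rpow (by positivity) hm.le, Real.mul_rpow (by norm_num) hD.le, hqdef,
        dispersiveConst_rpow hN b ht,
        show |t| ^ (-2 : ℝ) = |t| ^ (-(2 - b)) * |t| ^ (-b) by rw [← Real.rpow_add hT]; ring_nf]
      ring
  by_cases hM0 : M = 0
  · have := key 1 one_pos (by simp [hM0])
    rw [hM0, mul_zero] at this
    exact this.trans zero_le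
  · have hpos : 0 < M.toReal := ENNReal.toReal_pos hM0 hM.ne
    refine (key M.toReal hpos (ENNReal.ofReal_toReal hM.ne).ge).trans_eq ?_
    rw [← ENNReal.ofReal_rpow_of_pos hpos, ENNReal.ofReal_toReal hM.ne, mul_assoc]
    congr 1
    conv_lhs => rw [← ENNReal.rpow_one M, ← ENNReal.rpow_mul, ← ENNReal.rpow_add _ _ hM0 hM.ne]
    congr 1; ring

end INLS

theorem mainTheorem8 (N : ℕ) (b : ℝ) (hb0 : 0 < b) (hb : b < min 2 (N : ℝ)) :
    ∃ C : ℝ, 0 < C ∧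
      ∀ t : ℝ, t ≠ 0 →
        ∀ f : EuclideanSpace ℝ (Fin N) → ℂ, INLS.MemWeighted N b f →
          ∃ u : EuclideanSpace ℝ (Fin N) → ℂ,
            INLS.IsSchrodingerEvolution N t (INLS.nonlinearTerm N b f) u ∧
            INLS.MemWeighted N b u ∧
            INLS.weightedNorm N b u ≤
              ENNReal.ofReal (C * |t| ^ (-(2 / INLS.sigma N b))) *
                INLS.weightedNorm N b f ^ (INLS.sigma N b - 1) := by
  open INLS in
  obtain ⟨hb2, hbN⟩ := lt_min_iff.1 hb
  have hN : 0 < N := by exact_mod_cast hb0.trans hbN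
  have hq : 2 < sigma N b := by
    have : 0 < (4 - 2 * b) / N := div_pos (by linarith) (by exact_mod_cast hN)
    rw [sigma]; linarith
  have hq0 : 0 < sigma N b := by linarith
  have hc : 0 < powerConst N b := by
    have h1 : 0 < sigma N b - 2 := by linarith
    have h2 : 2 + ENNReal.ofReal (b / ((N + b) / 2 - b)) * localConst N ((N + b) / 2) ≠ ∞ := by
      have := localConst_ne_top hN (show ((N : ℝ) + b) / 2 < N by linarith)
      finiteness
    have h3 := ENNReal.toReal_pos (by simp) h2
    have := Real.pi_pos
    unfold powerConst
    positivity
  refine ⟨powerConst N b ^ (1 / sigma N b), by positivity, fun t ht f hf => ?_⟩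
  obtain ⟨hfm, hfin⟩ := hf
  have hac : weightedMeasure N b ≪ volume := withDensity_absolutelyContinuous _ _
  -- A Borel representative makes the level sets of f measurable; the nonlinear term changes only on
  -- a null set.
  set g := hfm.mk f with hg
  have hgm : Measurable g := hfm.stronglyMeasurable_mk.measurable
  have hfg : f =ᵐ[volume] g := hfm.ae_eq_mk
  rw [weightedNorm_eq b hfm] at hfin ⊢
  have hint : ∫⁻ x, ‖f x‖ₑ ^ sigma N b ∂weightedMeasure N b =
      ∫⁻ x, ‖g x‖ₑ ^ sigma N b ∂weightedMeasure N b := by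
    refine lintegral_congr_ae ?_
    filter_upwards [hac.ae_le hfg] with x hx
    rw [hx]
  rw [hint] at hfin ⊢
  have hM := (ENNReal.rpow_lt_top_iff_of_pos (by positivity)).1 hfin
  obtain ⟨u, hu, hle⟩ := exists_evolution_nonlinearTerm hN ht hb0 hbN hq hgm hM
  have hum := hu.aestronglyMeasurable
  have hbound : weightedNorm N b u ≤
      ENNReal.ofReal (powerConst N b ^ (1 / sigma N b) * |t| ^ (-(2 / sigma N b))) *
      ((∫⁻ x, ‖g x‖ₑ ^ sigma N b ∂weightedMeasure N b) ^ (1 / sigma N b)) ^ (sigma N b - 1) := by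
    rw [weightedNorm_eq b hum]
    refine (ENNReal.rpow_le_rpow hle (by positivity)).trans_eq ?_
    rw [ENNReal.mul_rpow_of_nonneg _ _ (by positivity), ← ENNReal.rpow_mul, ← ENNReal.rpow_mul,
      mul_comm (sigma N b - 1), ENNReal.ofReal_rpow_of_nonneg (by positivity) (by positivity),
      Real.mul_rpow hc.le (by positivity), ← Real.rpow_mul (abs_nonneg t)]
    congr 4
    ring
  refine ⟨u, hu.congr ?_, ⟨hum, hbound.trans_lt ?_⟩, hbound⟩
  · filter_upwards [hfg] with x hx
    simp only [nonlinearTerm, hx]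
  · exact ENNReal.mul_lt_top ENNReal.ofReal_lt_top
      (ENNReal.rpow_lt_top_of_nonneg (by linarith) hfin.ne)
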